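/- Let $G=(V,E)$ be a finite simple graph. For $U\subseteq V$ let $E(U)$ be the set of edges with both ends in $U$, let $\delta(U)$ be the set of edges with exactly one end in $U$, and write $\delta(v)=\delta(\{v\})$; for $x\in\mathbb{R}^E$ and $F\subseteq E$ write $x(F)=\sum_{e\in F}x_e$. Let $$\mathrm{Sp}(G)=\{x\in\mathbb{R}^E : x\ge 0,\ x(E(U))\le |U|-1 \text{ for all } \emptyset\ne U\subseteq V,\ x(E)=|V|-1\}$$ be the spanning tree polytope of $G$. Let $\emptyset\ne V_0\subsetneq V_1\subsetneq\dots\subsetneq V_k\subsetneq V$ with $k\ge 0$, and let $L_i=V_i\setminus V_{i-1}$ for $i=1,\dots,k$. A Gao-tree for this chain is a spanning tree of $G$ that contains exactly one edge of $\delta(V_i)$ for each $i=0,\dots,k$; let $\mathrm{Sp}_{\mathcal C}(G)\subseteq\mathbb{R}^E$ be the convex hull of the incidence vectors of the Gao-trees. A vector $x\in\mathbb{R}^E$ is a chain-point for the chain if (i) $x\in\mathrm{Sp}(G)$; (ii) $x(\delta(V_0))=x(\delta(V_k))=1$ and $x(\delta(V_i))<2$ for $i=1,\dots,k-1$; and (iii)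 $\sum_{v\in L_i}x(\delta(v))=2|L_i|$ for $i=1,\dots,k$. Theorem. Let $x$ be a chain-point for the chain, and let $\lambda=2-\max_{i=0,\dots,k}x(\delta(V_i))$. Then there exist $y\in\mathrm{Sp}_{\mathcal C}(G)$ and $x'\in\mathrm{Sp}(G)$ such that $$x=\lambda y+(1-\lambda)x'.$$ -/

import Mathlib

namespace GaoTrees

variable {V : Type*} [Fintype V] [DecidableEq V]

/-- The set of edges of `G` that join a vertex of `S₁` to a vertex of `S₂`. -/
def edgesBetween (G : SimpleGraph V) [DecidableRel G.Adj] (S₁ S₂ : Finset V) :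
    Finset G.edgeSet :=
  Finset.univ.filter fun e => ∃ i ∈ S₁, ∃ j ∈ S₂, (e : Sym2 V) = s(i, j)

/-- The set of edges of `G` induced by `S`. -/
def inducedEdges (G : SimpleGraph V) [DecidableRel G.Adj] (S : Finset V) : Finset G.edgeSet :=
  edgesBetween G S S

/-- The cut of `G` defined by `S`. -/
def cut (G : SimpleGraph V) [DecidableRel G.Adj] (S : Finset V) : Finset G.edgeSet :=
  edgesBetween G S Sᶜ

/-- The total weight `x(F) = ∑_{e ∈ F} x_e` of an edge set `F`. -/
noncomputable def weight {G : SimpleGraph V} (x : G.edgeSet → ℝ) (F : Finset G.edgeSet) : ℝ :=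
  ∑ e ∈ F, x e

/-- The incidence vector in `ℝ^E` of an edge set. -/
noncomputable def incidence {G : SimpleGraph V} (F : Finset G.edgeSet) : G.edgeSet → ℝ :=
  fun e => if e ∈ F then 1 else 0

/-- The edge set `T` forms a spanning tree: the graph with all vertices of `G` and with edge
set `T` is a tree. -/
def IsSpanningTree (G : SimpleGraph V) (T : Finset G.edgeSet) : Prop :=
  (SimpleGraph.fromEdgeSet (Subtype.val '' (T : Set G.edgeSet))).IsTree

/-- The spanning tree polytope of `G`. -/
def spanningTreePolytope (G : SimpleGraph V) [DecidableRel G.Adj] : Set (G.edgeSet → ℝ) :=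
  {x | (∀ e, 0 ≤ x e) ∧
    (∀ U : Finset V, U.Nonempty → weight x (inducedEdges G U) ≤ (U.card : ℝ) - 1) ∧
    weight x Finset.univ = (Fintype.card V : ℝ) - 1}

/-- `∅ ≠ C 0 ⊊ C 1 ⊊ ⋯ ⊊ C k ⊊ V`. -/
structure IsVertexChain {k : ℕ} (C : Fin (k + 1) → Finset V) : Prop where
  nonempty_zero : (C 0).Nonempty
  strictMono : StrictMono C
  last_ssubset : C (Fin.last k) ⊂ Finset.univ

/-- A Gao-tree for the chain `C`: a spanning tree that meets each cut `δ(C i)` in exactly one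
edge. -/
def IsGaoTree (G : SimpleGraph V) [DecidableRel G.Adj] {k : ℕ} (C : Fin (k + 1) → Finset V)
    (T : Finset G.edgeSet) : Prop :=
  IsSpanningTree G T ∧ ∀ i, (T ∩ cut G (C i)).card = 1

/-- The convex hull of (the incidence vectors of) the Gao-trees for the chain `C`. -/
def gaoTreePolytope (G : SimpleGraph V) [DecidableRel G.Adj] {k : ℕ}
    (C : Fin (k + 1) → Finset V) : Set (G.edgeSet → ℝ) :=
  convexHull ℝ {y | ∃ T : Finset G.edgeSet, IsGaoTree G C T ∧ y = incidence T}

/-- `x` is a chain-point for the chain `C`. In `level`, the set `C i.succ \ C i.castSucc`, for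
`i : Fin k`, runs through the level-sets `L₁, …, L_k`, where `L_j = C j \ C (j - 1)`. -/
structure IsChainPoint (G : SimpleGraph V) [DecidableRel G.Adj] {k : ℕ}
    (C : Fin (k + 1) → Finset V) (x : G.edgeSet → ℝ) : Prop where
  mem_polytope : x ∈ spanningTreePolytope G
  cut_zero : weight x (cut G (C 0)) = 1
  cut_last : weight x (cut G (C (Fin.last k))) = 1
  cut_lt : ∀ i, i ≠ 0 → i ≠ Fin.last k → weight x (cut G (C i)) < 2
  level : ∀ i : Fin k,
    ∑ v ∈ C i.succ \ C i.castSucc, weight x (cut G {v}) =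
      2 * ((C i.succ \ C i.castSucc).card : ℝ)

/-- The largest narrow cut size, `max_{i = 0, …, k} x(δ(C i))`. -/
noncomputable def maxNarrowCut (G : SimpleGraph V) [DecidableRel G.Adj] {k : ℕ}
    (C : Fin (k + 1) → Finset V) (x : G.edgeSet → ℝ) : ℝ :=
  Finset.univ.sup' Finset.univ_nonempty fun i => weight x (cut G (C i))

end GaoTrees

/-!
The two kinds of trees are the bases of two matroids on the edge set. For the layers
`L₀ = C 0, L₁, …, L_k` and `L_{k+1}`, the complement of the last member of the chain, a Gao-tree
consists of a spanning tree of each `G[L_i]` and of one edge between each two consecutive layers,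
so the Gao-trees are the bases of a direct sum of graphic matroids and uniform matroids of rank
one. Let `r₁` be the rank function of this matroid and `r` that of the graphic matroid of `G`.

If `x` were not in `λ Sp_C(G) + (1 - λ) Sp(G)`, a hyperplane given by edge weights `w` would
separate it from this polytope. A greedy Gao-tree and a greedy spanning tree for `w` contain
`r₁(F)` and `r(F)` edges of each of the sets `F = {e | r ≤ w e}`
(`exists_greedy_gaoTree`, `exists_greedy_spanningTree`), so summation by levels
(`sum_mul_nonneg_of_levels`) gives a contradiction as soon as
`x(F) ≤ λ r₁(F) + (1 - λ) r(F)` for all such `F`.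

This is `IsLayeredPoint.rank_inequality`. An edge set is described there by the partition `κ` of
the vertices into its components, the partition `q` into the components of its edges within
layers, and the set `B` of those `i` for which it joins `L_i` and `L_{i+1}`; then
`r = |V| - |κ|` and `r₁ = |V| - |q| + |B|`. The degree condition on the layers gives, for the slack
`σ_i = |L_i| - 1 - x(E(L_i))` and the weight `d_i` of the edges that jump over `L_i`, that
`σ_i + d_i ≤ 1 - λ` and `x(E(L_i, L_{i+1})) ≥ λ + σ_i + σ_{i+1}`. With these bounds one can merge
classes until each class of `κ` meets each layer in at most one class of `q`, and `B` contains `i`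
whenever a class of `κ` meets `L_i` and `L_{i+1}`. Then the classes of `κ` are cut at the layers
that they skip (at most `1 - λ` of weight is lost at each), and at the cuts of the chain that at
least two of them cross (at most `2 - λ` is lost). What remains are classes that meet intervals of
layers and do not overlap, for which the constraints of `Sp(G)` suffice.
-/

namespace GaoTrees

/-! ### Counting the classes of a labelling -/

section Labelling

variable {V : Type*}

theorem card_image_le_of_factor {S : Finset V} {κ q : V → ℕ}
    (h : ∀ u ∈ S, ∀ v ∈ S, q u = q v → κ u = κ v) : (S.image κ).card ≤ (S.image q).card := by
  classical
  have hsub : S.image κ ⊆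
      (S.image q).image fun c => if h : ∃ v ∈ S, q v = c then κ h.choose else 0 := by
    intro c hc
    obtain ⟨v, hv, rfl⟩ := Finset.mem_image.1 hc
    have hex : ∃ u ∈ S, q u = q v := ⟨v, hv, rfl⟩
    refine Finset.mem_image.2 ⟨q v, Finset.mem_image_of_mem q hv, ?_⟩
    rw [dif_pos hex]
    exact h _ hex.choose_spec.1 v hv hex.choose_spec.2
  exact (Finset.card_le_card hsub).trans Finset.card_image_le

theorem card_image_lt_of_factor {S : Finset V} {κ q : V → ℕ}
    (h : ∀ u ∈ S, ∀ v ∈ S, q u = q v → κ u = κ v) {a b : V} (ha : a ∈ S) (hb : b ∈ S)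
    (hκ : κ a = κ b) (hq : q a ≠ q b) : (S.image κ).card + 1 ≤ (S.image q).card := by
  have hsub : S.image κ ⊆ (S.filter fun w => q w ≠ q b).image κ := by
    intro c hc
    obtain ⟨w, hw, rfl⟩ := Finset.mem_image.1 hc
    rw [Finset.mem_image]
    by_cases hwb : q w = q b
    · exact ⟨a, Finset.mem_filter.2 ⟨ha, hq⟩, by rw [hκ, h w hw b hb hwb]⟩
    · exact ⟨w, Finset.mem_filter.2 ⟨hw, hwb⟩, rfl⟩
  have h1 := Finset.card_le_card hsub
  have h2 : ((S.filter fun w => q w ≠ q b).image κ).card ≤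
      ((S.filter fun w => q w ≠ q b).image q).card :=
    card_image_le_of_factor fun u hu v hv =>
      h u (Finset.mem_filter.1 hu).1 v (Finset.mem_filter.1 hv).1
  have h3 : (S.filter fun w => q w ≠ q b).image q ⊆ (S.image q).erase (q b) := by
    intro c hc
    obtain ⟨w, hw, rfl⟩ := Finset.mem_image.1 hc
    rw [Finset.mem_filter] at hw
    exact Finset.mem_erase.2 ⟨hw.2, Finset.mem_image_of_mem _ hw.1⟩
  have h4 := Finset.card_le_card h3
  have hmem : q b ∈ S.image q := Finset.mem_image_of_mem _ hb
  have h5 := Finset.card_erase_add_one hmem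
  omega

/-- The labelling obtained from `f` by merging all classes that meet `S` into the class
labelled `a`. -/
def mergeLabels (f : V → ℕ) (S : Finset V) (a : ℕ) : V → ℕ :=
  fun v => if f v ∈ S.image f then a else f v

theorem mergeLabels_of_mem {f : V → ℕ} {S : Finset V} {a : ℕ} {v : V} (hv : v ∈ S) :
    mergeLabels f S a v = a :=
  if_pos (Finset.mem_image_of_mem f hv)

theorem mergeLabels_congr {f : V → ℕ} {S : Finset V} {a : ℕ} {u v : V} (h : f u = f v) :
    mergeLabels f S a u = mergeLabels f S a v := by
  simp only [mergeLabels, h]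

theorem card_image_mergeLabels [Fintype V] {f : V → ℕ} {S : Finset V} {a : V} (ha : a ∈ S) :
    (Finset.univ.image (mergeLabels f S (f a))).card + (S.image f).card =
      (Finset.univ.image f).card + 1 := by
  have himg : Finset.univ.image (mergeLabels f S (f a)) =
      insert (f a) (Finset.univ.image f \ S.image f) := by
    ext c
    simp only [Finset.mem_image, Finset.mem_univ, true_and, Finset.mem_insert, Finset.mem_sdiff,
      mergeLabels]
    constructor
    · rintro ⟨v, rfl⟩
      split_ifs with h
      · exact Or.inl rfl
      · exact Or.inr ⟨⟨v, rfl⟩, h⟩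
    · rintro (rfl | ⟨⟨v, rfl⟩, h⟩)
      · exact ⟨a, if_pos ⟨a, ha, rfl⟩⟩
      · exact ⟨v, if_neg h⟩
  have hnot : f a ∉ Finset.univ.image f \ S.image f := fun h =>
    (Finset.mem_sdiff.1 h).2 (Finset.mem_image_of_mem f ha)
  have hsub : S.image f ⊆ Finset.univ.image f :=
    Finset.image_subset_image (Finset.subset_univ S)
  rw [himg, Finset.card_insert_of_notMem hnot, Finset.card_sdiff_of_subset hsub]
  have := Finset.card_le_card hsub
  omega

/-- Splitting every class of `κ` along the two sides of `p` adds one class for each class of `κ`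
that meets both sides. -/
theorem card_image_split [Fintype V] (κ : V → ℕ) (p : V → Prop) [DecidablePred p] :
    (Finset.univ.image fun v => 2 * κ v + if p v then 0 else 1).card =
      (Finset.univ.image κ).card +
        ((Finset.univ.filter p).image κ ∩ (Finset.univ.filter fun v => ¬ p v).image κ).card := by
  have h1 : (Finset.univ.image fun v => 2 * κ v + if p v then 0 else 1) =
      ((Finset.univ.filter p).image κ).image (fun a => 2 * a) ∪
        ((Finset.univ.filter fun v => ¬ p v).image κ).image (fun a => 2 * a + 1) := by
    ext c
    simp only [Finset.mem_image, Finset.mem_univ, true_and, Finset.mem_union, Finset.mem_filter]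
    constructor
    · rintro ⟨v, rfl⟩
      by_cases hv : p v
      · exact Or.inl ⟨κ v, ⟨v, hv, rfl⟩, by simp [hv]⟩
      · exact Or.inr ⟨κ v, ⟨v, hv, rfl⟩, by simp [hv]⟩
    · rintro (⟨_, ⟨v, hv, rfl⟩, rfl⟩ | ⟨_, ⟨v, hv, rfl⟩, rfl⟩)
      · exact ⟨v, by simp [hv]⟩
      · exact ⟨v, by simp [hv]⟩
  classical
  have h2 : Finset.univ.image κ =
      (Finset.univ.filter p).image κ ∪ (Finset.univ.filter fun v => ¬ p v).image κ := by
    rw [← Finset.image_union, Finset.filter_union_filter_not_eq]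
  have h3 : Function.Injective fun a : ℕ => 2 * a := fun a b h => by
    simpa using h
  have h4 : Function.Injective fun a : ℕ => 2 * a + 1 := fun a b h => by
    simpa using h
  rw [h1, h2, Finset.card_union_add_card_inter, Finset.card_union_of_disjoint,
    Finset.card_image_of_injective _ h3, Finset.card_image_of_injective _ h4]
  rw [Finset.disjoint_left]
  intro c hc hc'
  obtain ⟨a, -, rfl⟩ := Finset.mem_image.1 hc
  obtain ⟨b, -, hb⟩ := Finset.mem_image.1 hc'
  omega

end Labelling

/-! ### Edge masses -/

section Mass

variable {E : Type*} [Fintype E]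

open Classical in
/-- The total weight of the edges that satisfy `P`. -/
noncomputable def mass (x : E → ℝ) (P : E → Prop) : ℝ :=
  ∑ e, if P e then x e else 0

theorem mass_nonneg {x : E → ℝ} (hx : ∀ e, 0 ≤ x e) (P : E → Prop) : 0 ≤ mass x P :=
  Finset.sum_nonneg fun e _ => by split_ifs <;> simp [hx e]

theorem mass_mono {x : E → ℝ} (hx : ∀ e, 0 ≤ x e) {P Q : E → Prop} (h : ∀ e, P e → Q e) :
    mass x P ≤ mass x Q := by
  refine Finset.sum_le_sum fun e _ => ?_
  have := hx e
  have := h e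
  split_ifs <;> tauto

theorem mass_le_add {x : E → ℝ} (hx : ∀ e, 0 ≤ x e) {P Q R : E → Prop}
    (h : ∀ e, P e → Q e ∨ R e) : mass x P ≤ mass x Q + mass x R := by
  simp only [mass, ← Finset.sum_add_distrib]
  refine Finset.sum_le_sum fun e _ => ?_
  have := hx e
  have := h e
  split_ifs <;> first | tauto | linarith

theorem mass_add_le {x : E → ℝ} (hx : ∀ e, 0 ≤ x e) {P Q R : E → Prop}
    (h : ∀ e, P e → R e) (h' : ∀ e, Q e → R e ∧ ¬ P e) :
    mass x P + mass x Q ≤ mass x R := by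
  simp only [mass, ← Finset.sum_add_distrib]
  refine Finset.sum_le_sum fun e _ => ?_
  have := hx e
  have := h e
  have := h' e
  split_ifs <;> first | tauto | linarith

end Mass

/-! ### The rank inequality for layered points -/

section Layered

variable {V E : Type*} [Fintype V] [Fintype E]

/-- The vertices with index `i` under `ℓ`. -/
def layer (ℓ : V → ℕ) (i : ℕ) : Finset V := Finset.univ.filter fun v => ℓ v = i

@[simp] theorem mem_layer {ℓ : V → ℕ} {i : ℕ} {v : V} : v ∈ layer ℓ i ↔ ℓ v = i := by
  simp [layer]

/-- An edge with ends in layers `a` and `b` crosses the cut between layers `i` and `i + 1`. -/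
def Crosses (i a b : ℕ) : Prop := (a ≤ i ∧ i < b) ∨ (b ≤ i ∧ i < a)

/-- An edge with ends in layers `a` and `b` jumps over layer `i`. -/
def Jumps (i a b : ℕ) : Prop := (a < i ∧ i < b) ∨ (b < i ∧ i < a)

/-- An edge with ends in layers `a` and `b` joins the consecutive layers `i` and `i + 1`. -/
def Links (i a b : ℕ) : Prop := (a = i ∧ b = i + 1) ∨ (b = i ∧ a = i + 1)

/-- The slack of the spanning tree constraint of layer `i`. -/
noncomputable def layerSlack (s t : E → V) (x : E → ℝ) (ℓ : V → ℕ) (i : ℕ) : ℝ :=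
  ((layer ℓ i).card : ℝ) - 1 - mass x fun e => ℓ (s e) = i ∧ ℓ (t e) = i

/-- The properties of a chain-point used for the rank inequality, in terms of the index
`ℓ v ∈ {0, …, n}` of the layer of a vertex `v`. The graph is given by the two ends `s e` and
`t e` of each edge `e`. The last two fields bound the slack of the spanning tree constraint of a
layer in terms of the edges that jump over it, and the weight between consecutive layers. -/
structure IsLayeredPoint (s t : E → V) (x : E → ℝ) (ℓ : V → ℕ) (n : ℕ) (lam : ℝ) : Prop where
  nonneg : ∀ e, 0 ≤ x e
  lam_pos : 0 < lam
  lam_le_one : lam ≤ 1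
  index_le : ∀ v, ℓ v ≤ n
  layer_nonempty : ∀ i ≤ n, (layer ℓ i).Nonempty
  mass_inside_le : ∀ U : Finset V, U.Nonempty →
    mass x (fun e => s e ∈ U ∧ t e ∈ U) ≤ (U.card : ℝ) - 1
  mass_univ : mass x (fun _ => True) = (Fintype.card V : ℝ) - 1
  mass_crosses_le : ∀ i < n, mass x (fun e => Crosses i (ℓ (s e)) (ℓ (t e))) ≤ 2 - lam
  slack_add_jumps_le : ∀ i ≤ n,
    layerSlack s t x ℓ i + mass x (fun e => Jumps i (ℓ (s e)) (ℓ (t e))) ≤ 1 - lam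
  le_links : ∀ i < n, lam + layerSlack s t x ℓ i + layerSlack s t x ℓ (i + 1) ≤
    mass x fun e => Links i (ℓ (s e)) (ℓ (t e))

/-- Given labels `q` for the classes of a partition that refines the layers, labels `κ` for the
classes of a coarser partition, and a set `B` of indices, this says that `e` either lies in a
class of `q`, or joins two layers and lies in a class of `κ`, where the edges between layers `i`
and `i + 1` are excluded unless `i ∈ B`. -/
def Allowed (s t : E → V) (ℓ q κ : V → ℕ) (B : Finset ℕ) (e : E) : Prop :=
  q (s e) = q (t e) ∨ (κ (s e) = κ (t e) ∧ ℓ (s e) ≠ ℓ (t e) ∧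
    ∀ i, Links i (ℓ (s e)) (ℓ (t e)) → i ∈ B)

variable {s t : E → V} {x : E → ℝ} {ℓ : V → ℕ} {n : ℕ} {lam : ℝ}

theorem IsLayeredPoint.mass_same_label_le (h : IsLayeredPoint s t x ℓ n lam) (S : Finset V)
    (f : V → ℕ) : mass x (fun e => s e ∈ S ∧ t e ∈ S ∧ f (s e) = f (t e)) ≤
      (S.card : ℝ) - (S.image f).card := by
  classical
  have h1 : mass x (fun e => s e ∈ S ∧ t e ∈ S ∧ f (s e) = f (t e)) ≤
      ∑ a ∈ S.image f, mass x fun e => s e ∈ S.filter (f · = a) ∧ t e ∈ S.filter (f · = a) := by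
    simp only [mass]
    rw [Finset.sum_comm]
    refine Finset.sum_le_sum fun e _ => ?_
    by_cases he : s e ∈ S ∧ t e ∈ S ∧ f (s e) = f (t e)
    · rw [if_pos he]
      refine le_trans ?_ (Finset.single_le_sum
        (fun a _ => by split_ifs <;> simp [h.nonneg e]) (Finset.mem_image_of_mem f he.1))
      rw [if_pos]
      simp [he.1, he.2.1, he.2.2]
    · rw [if_neg he]
      exact Finset.sum_nonneg fun a _ => by split_ifs <;> simp [h.nonneg e]
  have h2 : ∀ a ∈ S.image f,
      mass x (fun e => s e ∈ S.filter (f · = a) ∧ t e ∈ S.filter (f · = a)) ≤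
        ((S.filter (f · = a)).card : ℝ) - 1 := by
    intro a ha
    obtain ⟨v, hv, rfl⟩ := Finset.mem_image.1 ha
    exact h.mass_inside_le _ ⟨v, by simp [hv]⟩
  have h3 := Finset.card_eq_sum_card_image f S
  calc _ ≤ _ := h1
    _ ≤ _ := Finset.sum_le_sum h2
    _ = _ := by
      rw [Finset.sum_sub_distrib, h3]
      push_cast
      simp

/-- A layer loses little weight when it is partitioned: its constraint is almost tight. -/
theorem IsLayeredPoint.le_mass_separated (h : IsLayeredPoint s t x ℓ n lam) (i : ℕ) (q : V → ℕ) :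
    (((layer ℓ i).image q).card : ℝ) - 1 - layerSlack s t x ℓ i ≤
      mass x fun e => ℓ (s e) = i ∧ ℓ (t e) = i ∧ q (s e) ≠ q (t e) := by
  have h1 := h.mass_same_label_le (layer ℓ i) q
  have h2 : mass x (fun e => ℓ (s e) = i ∧ ℓ (t e) = i) ≤
      mass x (fun e => s e ∈ layer ℓ i ∧ t e ∈ layer ℓ i ∧ q (s e) = q (t e)) +
      mass x fun e => ℓ (s e) = i ∧ ℓ (t e) = i ∧ q (s e) ≠ q (t e) :=
    mass_le_add h.nonneg fun e he => by simp only [mem_layer]; tauto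
  unfold layerSlack
  linarith

theorem IsLayeredPoint.layerSlack_nonneg (h : IsLayeredPoint s t x ℓ n lam) {i : ℕ}
    (hi : i ≤ n) : 0 ≤ layerSlack s t x ℓ i := by
  have := h.mass_inside_le (layer ℓ i) (h.layer_nonempty i hi)
  simp only [mem_layer] at this
  unfold layerSlack
  linarith

theorem IsLayeredPoint.layerSlack_le (h : IsLayeredPoint s t x ℓ n lam) {i : ℕ} (hi : i ≤ n) :
    layerSlack s t x ℓ i ≤ 1 - lam := by
  have := h.slack_add_jumps_le i hi
  have := mass_nonneg h.nonneg fun e => Jumps i (ℓ (s e)) (ℓ (t e))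
  linarith

theorem IsLayeredPoint.mass_jumps_le (h : IsLayeredPoint s t x ℓ n lam) {i : ℕ} (hi : i ≤ n) :
    mass x (fun e => Jumps i (ℓ (s e)) (ℓ (t e))) ≤ 1 - lam := by
  have := h.slack_add_jumps_le i hi
  have := h.layerSlack_nonneg hi
  linarith

/-- If no class of `κ` skips a layer, and no two classes cross the same cut, then the classes of
`κ` carry at most `|V| - |κ|` of weight, and this is at most the bound wanted. -/
theorem IsLayeredPoint.rank_inequality_of_intervals (h : IsLayeredPoint s t x ℓ n lam)
    {q κ : V → ℕ} {B : Finset ℕ} (hq : ∀ u v, q u = q v → ℓ u = ℓ v ∧ κ u = κ v)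
    (h1 : ∀ u v, κ u = κ v → ℓ u = ℓ v → q u = q v)
    (h2 : ∀ u v, κ u = κ v → ℓ v = ℓ u + 1 → ℓ u ∈ B)
    (h3 : ∀ u v u' v', κ u = κ v → κ u' = κ v' → ℓ v = ℓ u + 1 → ℓ v' = ℓ u' + 1 → ℓ u = ℓ u' →
      κ u = κ u')
    (h4 : ∀ u v j, κ u = κ v → ℓ u < j → j < ℓ v → ∃ w, κ w = κ u ∧ ℓ w = j) :
    mass x (Allowed s t ℓ q κ B) ≤
      lam * (Fintype.card V - (Finset.univ.image q).card + B.card) +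
        (1 - lam) * (Fintype.card V - (Finset.univ.image κ).card) := by
  have hmass : mass x (Allowed s t ℓ q κ B) ≤
      (Fintype.card V : ℝ) - (Finset.univ.image κ).card := by
    refine le_trans (mass_mono h.nonneg ?_) (h.mass_same_label_le Finset.univ κ)
    rintro e (he | he)
    · simp [(hq _ _ he).2]
    · simp [he.1]
  -- A class of `q` in the first layer of its class of `κ` is counted by that class of `κ`, and
  -- any other class of `q`, in layer `i + 1`, say, is counted by `i ∈ B`.
  have hcard : (Finset.univ.image q).card ≤ (Finset.univ.image κ).card + B.card := by
    classical
    -- Even values of `f` encode elements of `B`, odd ones encode classes of `κ`.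
    let f : V → ℕ := fun v =>
      if ∃ u, κ u = κ v ∧ ℓ v = ℓ u + 1 then 2 * (ℓ v - 1) else 2 * κ v + 1
    have hf : ∀ u v, f u = f v → ℓ u = ℓ v ∧ κ u = κ v := by
      intro u v huv
      simp only [f] at huv
      split_ifs at huv with hu hv hv
      · obtain ⟨u', hu1, hu2⟩ := hu
        obtain ⟨v', hv1, hv2⟩ := hv
        have := h3 u' u v' v hu1 hv1 hu2 hv2 (by omega)
        exact ⟨by omega, by rw [← hu1, this, hv1]⟩
      · omega
      · omega
      · have hκ : κ u = κ v := by omega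
        refine ⟨?_, hκ⟩
        by_contra hne
        rcases Nat.lt_or_gt_of_ne hne with hlt | hlt
        · apply hv
          by_cases hj : ℓ v = ℓ u + 1
          · exact ⟨u, hκ, hj⟩
          · obtain ⟨w, hw1, hw2⟩ := h4 u v (ℓ v - 1) hκ (by omega) (by omega)
            exact ⟨w, by omega, by omega⟩
        · apply hu
          by_cases hj : ℓ u = ℓ v + 1
          · exact ⟨v, hκ.symm, hj⟩
          · obtain ⟨w, hw1, hw2⟩ := h4 v u (ℓ u - 1) hκ.symm (by omega) (by omega)
            exact ⟨w, by omega, by omega⟩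
    have hsub : Finset.univ.image f ⊆
        (Finset.univ.image κ).image (fun a => 2 * a + 1) ∪ B.image (fun b => 2 * b) := by
      intro c hc
      obtain ⟨v, -, rfl⟩ := Finset.mem_image.1 hc
      simp only [f]
      split_ifs with hv
      · obtain ⟨u, hu1, hu2⟩ := hv
        refine Finset.mem_union_right _ (Finset.mem_image.2 ⟨ℓ u, h2 u v hu1 hu2, by omega⟩)
      · exact Finset.mem_union_left _ (Finset.mem_image_of_mem (fun a => 2 * a + 1)
          (Finset.mem_image_of_mem κ (Finset.mem_univ v)))
    calc (Finset.univ.image q).card ≤ (Finset.univ.image f).card :=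
          card_image_le_of_factor fun u _ v _ huv => h1 u v (hf u v huv).2 (hf u v huv).1
      _ ≤ _ := (Finset.card_le_card hsub).trans (Finset.card_union_le _ _)
      _ ≤ _ := add_le_add Finset.card_image_le Finset.card_image_le
  have hcard' : ((Finset.univ.image q).card : ℝ) ≤ (Finset.univ.image κ).card + B.card := by
    exact_mod_cast hcard
  have hnn := mul_le_mul_of_nonneg_left hcard' h.lam_pos.le
  linarith

/-- The rank inequality when each class of `κ` meets each layer in at most one class of `q` and
`B` contains all `i` such that some class of `κ` meets the layers `i` and `i + 1`. A class of `κ`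
that skips a layer can be split there, and if at least two classes of `κ` meet the same two
consecutive layers, all classes can be split along the cut between these layers. Either operation
decreases the right-hand side by at least as much as the left-hand side. -/
theorem IsLayeredPoint.rank_inequality_of_closed (h : IsLayeredPoint s t x ℓ n lam)
    {q κ : V → ℕ} {B : Finset ℕ}
    (hq : ∀ u v, q u = q v → ℓ u = ℓ v ∧ κ u = κ v)
    (h1 : ∀ u v, κ u = κ v → ℓ u = ℓ v → q u = q v)
    (h2 : ∀ u v, κ u = κ v → ℓ v = ℓ u + 1 → ℓ u ∈ B) :
    mass x (Allowed s t ℓ q κ B) ≤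
      lam * (Fintype.card V - (Finset.univ.image q).card + B.card) +
        (1 - lam) * (Fintype.card V - (Finset.univ.image κ).card) := by
  obtain ⟨m, hm⟩ : ∃ m, Fintype.card V + 1 ≤ (Finset.univ.image κ).card + m :=
    ⟨Fintype.card V + 1, by omega⟩
  induction m generalizing κ B with
  | zero =>
    have hle : (Finset.univ.image κ).card ≤ Fintype.card V := Finset.card_image_le
    omega
  | succ m ih =>
    by_cases h4 : ∀ u v j, κ u = κ v → ℓ u < j → j < ℓ v → ∃ w, κ w = κ u ∧ ℓ w = j
    · by_cases h3 : ∀ u v u' v', κ u = κ v → κ u' = κ v' → ℓ v = ℓ u + 1 → ℓ v' = ℓ u' + 1 →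
          ℓ u = ℓ u' → κ u = κ u'
      · exact h.rank_inequality_of_intervals hq h1 h2 h3 h4
      · push Not at h3
        obtain ⟨u, v, u', v', hκ, hκ', hv, hv', huu', hne⟩ := h3
        have hB : ℓ u ∈ B := h2 u v hκ hv
        have hn : ℓ u < n := by have := h.index_le v; omega
        -- The cut carries weight at most `2 - λ`, while the right-hand side loses `λ` since `ℓ u`
        -- leaves `B`, and at least `2 (1 - λ)` since at least two classes are split.
        set κ' : V → ℕ := fun w => 2 * κ w + if ℓ w ≤ ℓ u then 0 else 1 with hκ'_def
        have hsame : ∀ w w', κ' w = κ' w' ↔ κ w = κ w' ∧ (ℓ w ≤ ℓ u ↔ ℓ w' ≤ ℓ u) := by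
          intro w w'
          simp only [hκ'_def]
          split_ifs <;> constructor <;> intro H <;> omega
        have hcard : (Finset.univ.image κ).card + 2 ≤ (Finset.univ.image κ').card := by
          rw [hκ'_def, card_image_split κ (fun w => ℓ w ≤ ℓ u)]
          have hpair : ({κ u, κ u'} : Finset ℕ) ⊆ (Finset.univ.filter fun w => ℓ w ≤ ℓ u).image κ ∩
              (Finset.univ.filter fun w => ¬ ℓ w ≤ ℓ u).image κ := by
            intro c hc
            simp only [Finset.mem_insert, Finset.mem_singleton] at hc
            simp only [Finset.mem_inter, Finset.mem_image, Finset.mem_filter, Finset.mem_univ,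
              true_and]
            rcases hc with rfl | rfl
            · exact ⟨⟨u, le_rfl, rfl⟩, ⟨v, by omega, hκ.symm⟩⟩
            · exact ⟨⟨u', by omega, rfl⟩, ⟨v', by omega, hκ'.symm⟩⟩
          have := Finset.card_le_card hpair
          rw [Finset.card_pair hne] at this
          omega
        have hIH := ih (κ := κ') (B := B.erase (ℓ u))
          (fun w w' hw => ⟨(hq w w' hw).1, (hsame w w').2 ⟨(hq w w' hw).2, by
            rw [(hq w w' hw).1]⟩⟩)
          (fun w w' hw hl => h1 w w' ((hsame w w').1 hw).1 hl)
          (fun w w' hw hl => by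
            have hw' := (hsame w w').1 hw
            refine Finset.mem_erase.2 ⟨?_, h2 w w' hw'.1 hl⟩
            omega)
          (by omega)
        have hmass : mass x (Allowed s t ℓ q κ B) ≤ mass x (Allowed s t ℓ q κ' (B.erase (ℓ u))) +
            mass x fun e => Crosses (ℓ u) (ℓ (s e)) (ℓ (t e)) := by
          refine mass_le_add h.nonneg fun e he => ?_
          rcases he with he | ⟨he1, he2, he3⟩
          · exact Or.inl (Or.inl he)
          · by_cases hc : Crosses (ℓ u) (ℓ (s e)) (ℓ (t e))
            · exact Or.inr hc
            · refine Or.inl (Or.inr ⟨(hsame _ _).2 ⟨he1, ?_⟩, he2, fun i hi =>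
                Finset.mem_erase.2 ⟨?_, he3 i hi⟩⟩)
              · unfold Crosses at hc
                omega
              · unfold Crosses at hc
                unfold Links at hi
                omega
        have ha := h.mass_crosses_le (ℓ u) hn
        have hBc : ((B.erase (ℓ u)).card : ℝ) + 1 = B.card := by
          exact_mod_cast Finset.card_erase_add_one hB
        have hcard' : ((Finset.univ.image κ).card : ℝ) + 2 ≤ (Finset.univ.image κ').card := by
          exact_mod_cast hcard
        have hmul := mul_le_mul_of_nonneg_left hcard' (sub_nonneg.2 h.lam_le_one)
        rw [← hBc]
        linarith
    · push Not at h4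
      obtain ⟨u, v, j, hκ, huj, hjv, hgap⟩ := h4
      have hn : j ≤ n := by have := h.index_le v; omega
      -- Only edges that jump over layer `j` are lost, and these have weight at most `1 - λ`.
      set κ' : V → ℕ := fun w => 2 * κ w + if κ w = κ u ∧ ℓ w ≤ j then 0 else 1 with hκ'_def
      have hsame : ∀ w w', κ' w = κ' w' ↔
          κ w = κ w' ∧ (κ w = κ u → (ℓ w ≤ j ↔ ℓ w' ≤ j)) := by
        intro w w'
        simp only [hκ'_def]
        split_ifs <;> constructor <;> intro H <;> omega
      have hcard : (Finset.univ.image κ).card + 1 ≤ (Finset.univ.image κ').card :=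
        card_image_lt_of_factor (fun w _ w' _ hw => ((hsame w w').1 hw).1) (Finset.mem_univ u)
          (Finset.mem_univ v) hκ (fun hw => by have := ((hsame u v).1 hw).2 rfl; omega)
      have hIH := ih (κ := κ') (B := B)
        (fun w w' hw => ⟨(hq w w' hw).1, (hsame w w').2 ⟨(hq w w' hw).2, fun _ => by
          rw [(hq w w' hw).1]⟩⟩)
        (fun w w' hw hl => h1 w w' ((hsame w w').1 hw).1 hl)
        (fun w w' hw hl => h2 w w' ((hsame w w').1 hw).1 hl)
        (by omega)
      have hmass : mass x (Allowed s t ℓ q κ B) ≤ mass x (Allowed s t ℓ q κ' B) +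
          mass x fun e => Jumps j (ℓ (s e)) (ℓ (t e)) := by
        refine mass_le_add h.nonneg fun e he => ?_
        rcases he with he | ⟨he1, he2, he3⟩
        · exact Or.inl (Or.inl he)
        · by_cases hc : Jumps j (ℓ (s e)) (ℓ (t e))
          · exact Or.inr hc
          · refine Or.inl (Or.inr ⟨(hsame _ _).2 ⟨he1, fun hu => ?_⟩, he2, he3⟩)
            have hs := hgap (s e) hu
            have ht := hgap (t e) (he1.symm.trans hu)
            unfold Jumps at hc
            omega
      have hd := h.mass_jumps_le hn
      have hcard' : ((Finset.univ.image κ).card : ℝ) + 1 ≤ (Finset.univ.image κ').card := by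
        exact_mod_cast hcard
      have hmul := mul_le_mul_of_nonneg_left hcard' (sub_nonneg.2 h.lam_le_one)
      linarith

theorem mergeLabels_layer {q : V → ℕ} (hq : ∀ u v, q u = q v → ℓ u = ℓ v) {i : ℕ} (a : ℕ)
    (w : V) : mergeLabels q (layer ℓ i) a w = if ℓ w = i then a else q w := by
  refine if_congr ?_ rfl rfl
  simp only [Finset.mem_image, mem_layer]
  constructor
  · rintro ⟨w', hw', hww⟩
    rw [← hq _ _ hww, hw']
  · exact fun hw => ⟨w, hw, rfl⟩

/-- The inequality `x(F) ≤ λ r₁(F) + (1 - λ) r(F)` between the point and the rank functions `r₁`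
of the Gao-trees and `r` of the spanning trees, where `F` is the set of allowed edges, with the
ranks replaced by their values for the case that the classes of `q` and `κ` are connected by the
edges of `F` within layers and by all edges of `F`, and that `B` is the set of `i` for which `F`
joins the layers `i` and `i + 1`.

It suffices to treat partitions to which neither of two operations applies, since each of them
increases the left-hand side by at least as much as the right-hand side. If a layer contains two
classes of `q` in the same class of `κ`, the first operation merges all classes of `q` in this
layer, and all classes of `κ` that meet it. If some class of `κ` meets two consecutive layers
between which no edges are allowed, the second operation merges the classes of `q` in each of the
two layers and all classes of `κ` that meet one of them, and allows the edges between them. -/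
theorem IsLayeredPoint.rank_inequality (h : IsLayeredPoint s t x ℓ n lam)
    {q κ : V → ℕ} {B : Finset ℕ} (hq : ∀ u v, q u = q v → ℓ u = ℓ v ∧ κ u = κ v) :
    mass x (Allowed s t ℓ q κ B) ≤
      lam * (Fintype.card V - (Finset.univ.image q).card + B.card) +
        (1 - lam) * (Fintype.card V - (Finset.univ.image κ).card) := by
  obtain ⟨m, hm⟩ : ∃ m, (Finset.univ.image q).card + (Finset.range n \ B).card ≤ m := ⟨_, le_rfl⟩
  induction m using Nat.strong_induction_on generalizing q κ B with
  | _ m ih =>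
    by_cases h1 : ∀ u v, κ u = κ v → ℓ u = ℓ v → q u = q v
    · by_cases h2 : ∀ u v, κ u = κ v → ℓ v = ℓ u + 1 → ℓ u ∈ B
      · exact h.rank_inequality_of_closed hq h1 h2
      · push Not at h2
        obtain ⟨u, v, hκ, hl, hB⟩ := h2
        have hn : ℓ u < n := by have := h.index_le v; omega
        classical
        set S := layer ℓ (ℓ u) ∪ layer ℓ (ℓ u + 1) with hS
        have huS : u ∈ S := by simp [hS]
        have hvS : v ∈ S := by simp [hS, hl]
        set q₁ := mergeLabels q (layer ℓ (ℓ u)) (q u) with hq₁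
        set q' := mergeLabels q₁ (layer ℓ (ℓ u + 1)) (q₁ v) with hq'
        set κ' := mergeLabels κ S (κ u) with hκ'
        have hq₁v := mergeLabels_layer (fun u v huv => (hq u v huv).1) (i := ℓ u) (q u)
        rw [← hq₁] at hq₁v
        have hq₁ℓ : ∀ w w', q₁ w = q₁ w' → ℓ w = ℓ w' := by
          intro w w' hw
          rw [hq₁v, hq₁v] at hw
          split_ifs at hw with h3 h4 h4
          · omega
          · have := (hq _ _ hw).1; omega
          · have := (hq _ _ hw).1; omega
          · exact (hq _ _ hw).1
        have hq'v := mergeLabels_layer hq₁ℓ (i := ℓ u + 1) (q₁ v)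
        rw [← hq'] at hq'v
        have hq'ℓ : ∀ w w', q' w = q' w' → ℓ w = ℓ w' := by
          intro w w' hw
          rw [hq'v, hq'v] at hw
          split_ifs at hw with h3 h4 h4
          · omega
          · have := hq₁ℓ _ _ hw; omega
          · have := hq₁ℓ _ _ hw; omega
          · exact hq₁ℓ _ _ hw
        have hq'κ : ∀ w w', q' w = q' w' → κ' w = κ' w' := by
          intro w w' hw
          have hℓ := hq'ℓ w w' hw
          by_cases hwS : w ∈ S
          · have hwS' : w' ∈ S := by
              simp only [hS, Finset.mem_union, mem_layer] at hwS ⊢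
              omega
            rw [hκ', mergeLabels_of_mem hwS, mergeLabels_of_mem hwS']
          · simp only [hS, Finset.mem_union, mem_layer] at hwS
            rw [hq'v, hq'v, if_neg (by omega), if_neg (by omega), hq₁v, hq₁v, if_neg (by omega),
              if_neg (by omega)] at hw
            exact mergeLabels_congr (hq _ _ hw).2
        have hq'eq : ∀ w w', q w = q w' → q' w = q' w' := fun w w' hw =>
          mergeLabels_congr (mergeLabels_congr hw)
        have hc1 := card_image_mergeLabels (f := q) (S := layer ℓ (ℓ u)) (a := u) (by simp)
        have hc2 := card_image_mergeLabels (f := q₁) (S := layer ℓ (ℓ u + 1)) (a := v) (by simp [hl])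
        have hc3 := card_image_mergeLabels (f := κ) huS
        have hc4 := card_image_lt_of_factor (fun w _ w' _ hw => (hq w w' hw).2) huS hvS hκ
          (fun hw => by have := (hq _ _ hw).1; omega)
        have hc5 : (layer ℓ (ℓ u + 1)).image q₁ = (layer ℓ (ℓ u + 1)).image q := by
          refine Finset.image_congr fun w hw => ?_
          have hw' : ℓ w = ℓ u + 1 := by simpa using hw
          rw [hq₁v, if_neg (by omega)]
        have hc6 : (S.image q).card ≤
            ((layer ℓ (ℓ u)).image q).card + ((layer ℓ (ℓ u + 1)).image q).card := by
          rw [hS, Finset.image_union]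
          exact Finset.card_union_le _ _
        have hc7 : 0 < ((layer ℓ (ℓ u)).image q).card :=
          Finset.card_pos.2 ⟨q u, Finset.mem_image_of_mem q (by simp)⟩
        have hc8 : 0 < ((layer ℓ (ℓ u + 1)).image q).card :=
          Finset.card_pos.2 ⟨q v, Finset.mem_image_of_mem q (by simp [hl])⟩
        have hc9 : (Finset.range n \ insert (ℓ u) B).card < (Finset.range n \ B).card := by
          rw [Finset.sdiff_insert]
          exact Finset.card_erase_lt_of_mem (by simp [hn, hB])
        rw [hc5, ← hq'] at hc2
        rw [← hq₁] at hc1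
        rw [← hκ'] at hc3
        have hIH := ih ((Finset.univ.image q').card + (Finset.range n \ insert (ℓ u) B).card)
          (by omega) (q := q') (κ := κ') (B := insert (ℓ u) B)
          (fun w w' hw => ⟨hq'ℓ w w' hw, hq'κ w w' hw⟩) le_rfl
        rw [Finset.card_insert_of_notMem hB] at hIH
        -- The edges that become allowed: those that separate classes of `q` in either layer, and
        -- those between the two layers.
        have hm1 := mass_add_le h.nonneg (P := Allowed s t ℓ q κ B)
          (Q := fun e => ℓ (s e) = ℓ u ∧ ℓ (t e) = ℓ u ∧ q (s e) ≠ q (t e))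
          (R := fun e => Allowed s t ℓ q κ B e ∨ (ℓ (s e) = ℓ u ∧ ℓ (t e) = ℓ u ∧
            q (s e) ≠ q (t e))) (fun e he => Or.inl he)
          (fun e he => ⟨Or.inr he, fun hA => hA.elim he.2.2 fun hA => hA.2.1 (by omega)⟩)
        have hm2 := mass_add_le h.nonneg
          (P := fun e => Allowed s t ℓ q κ B e ∨ (ℓ (s e) = ℓ u ∧ ℓ (t e) = ℓ u ∧
            q (s e) ≠ q (t e)))
          (Q := fun e => ℓ (s e) = ℓ u + 1 ∧ ℓ (t e) = ℓ u + 1 ∧ q (s e) ≠ q (t e))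
          (R := fun e => (Allowed s t ℓ q κ B e ∨ (ℓ (s e) = ℓ u ∧ ℓ (t e) = ℓ u ∧
            q (s e) ≠ q (t e))) ∨ (ℓ (s e) = ℓ u + 1 ∧ ℓ (t e) = ℓ u + 1 ∧ q (s e) ≠ q (t e)))
          (fun e he => Or.inl he)
          (fun e he => ⟨Or.inr he, fun hA => hA.elim
            (fun hA => hA.elim he.2.2 fun hA => hA.2.1 (by omega)) fun hA => by omega⟩)
        have hm3 := mass_add_le h.nonneg
          (P := fun e => (Allowed s t ℓ q κ B e ∨ (ℓ (s e) = ℓ u ∧ ℓ (t e) = ℓ u ∧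
            q (s e) ≠ q (t e))) ∨ (ℓ (s e) = ℓ u + 1 ∧ ℓ (t e) = ℓ u + 1 ∧ q (s e) ≠ q (t e)))
          (Q := fun e => Links (ℓ u) (ℓ (s e)) (ℓ (t e)))
          (R := Allowed s t ℓ q' κ' (insert (ℓ u) B))
          (fun e he => by
            rcases he with (he | he) | he
            · rcases he with he | ⟨he1, he2, he3⟩
              · exact Or.inl (hq'eq _ _ he)
              · exact Or.inr ⟨mergeLabels_congr he1, he2, fun i hi =>
                  Finset.mem_insert_of_mem (he3 i hi)⟩
            · refine Or.inl ?_
              rw [hq'v, hq'v, hq₁v (s e), hq₁v (t e), he.1, he.2.1]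
              simp
            · refine Or.inl ?_
              rw [hq'v, hq'v, if_pos he.1, if_pos he.2.1])
          (fun e he => by
            have he' := he
            unfold Links at he'
            have hsS : s e ∈ S := by
              simp only [hS, Finset.mem_union, mem_layer]
              omega
            have htS : t e ∈ S := by
              simp only [hS, Finset.mem_union, mem_layer]
              omega
            refine ⟨Or.inr ⟨?_, by omega, fun i hi => ?_⟩, ?_⟩
            · rw [hκ', mergeLabels_of_mem hsS, mergeLabels_of_mem htS]
            · have : i = ℓ u := by
                unfold Links at hi
                omega
              rw [this]
              exact Finset.mem_insert_self _ _
            · rintro ((hA | hA) | hA)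
              · rcases hA with hA | hA
                · have := (hq _ _ hA).1
                  omega
                · exact hB (hA.2.2 _ he)
              · omega
              · omega)
        have hs1 := h.le_mass_separated (ℓ u) q
        have hs2 := h.le_mass_separated (ℓ u + 1) q
        have hs3 := h.le_links (ℓ u) hn
        have hQ : ((Finset.univ.image q').card : ℝ) = (Finset.univ.image q).card + 2 -
            ((layer ℓ (ℓ u)).image q).card - ((layer ℓ (ℓ u + 1)).image q).card := by
          have : (Finset.univ.image q').card + ((layer ℓ (ℓ u)).image q).card +
            ((layer ℓ (ℓ u + 1)).image q).card = (Finset.univ.image q).card + 2 := by omega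
          have : ((Finset.univ.image q').card : ℝ) + ((layer ℓ (ℓ u)).image q).card +
            ((layer ℓ (ℓ u + 1)).image q).card = (Finset.univ.image q).card + 2 := by
              exact_mod_cast this
          linarith
        have hK : ((Finset.univ.image κ).card : ℝ) + 2 ≤ (Finset.univ.image κ').card +
            (((layer ℓ (ℓ u)).image q).card + ((layer ℓ (ℓ u + 1)).image q).card) := by
          have : (Finset.univ.image κ).card + 2 ≤ (Finset.univ.image κ').card +
            (((layer ℓ (ℓ u)).image q).card + ((layer ℓ (ℓ u + 1)).image q).card) := by omega
          exact_mod_cast this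
        have hmul := mul_le_mul_of_nonneg_left hK (sub_nonneg.2 h.lam_le_one)
        rw [hQ] at hIH
        push_cast at hIH
        linarith
    · push Not at h1
      obtain ⟨u, v, hκ, hl, hquv⟩ := h1
      set S := layer ℓ (ℓ u) with hS
      have huS : u ∈ S := by simp [hS]
      have hvS : v ∈ S := by simp [hS, hl]
      set q' := mergeLabels q S (q u) with hq'
      set κ' := mergeLabels κ S (κ u) with hκ'
      have hq'v := mergeLabels_layer (fun u v huv => (hq u v huv).1) (i := ℓ u) (q u)
      rw [← hS, ← hq'] at hq'v
      have hq'ℓ : ∀ w w', q' w = q' w' → ℓ w = ℓ w' := by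
        intro w w' hw
        rw [hq'v, hq'v] at hw
        split_ifs at hw with h3 h4 h4
        · omega
        · have := (hq _ _ hw).1; omega
        · have := (hq _ _ hw).1; omega
        · exact (hq _ _ hw).1
      have hq'κ : ∀ w w', q' w = q' w' → κ' w = κ' w' := by
        intro w w' hw
        have hℓ := hq'ℓ w w' hw
        by_cases hwS : ℓ w = ℓ u
        · rw [hκ', mergeLabels_of_mem (by simpa [hS] using hwS),
            mergeLabels_of_mem (by simp [hS, ← hℓ, hwS])]
        · rw [hq'v, hq'v, if_neg (by omega), if_neg (by omega)] at hw
          exact mergeLabels_congr (hq _ _ hw).2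
      have hc1 := card_image_mergeLabels (f := q) huS
      have hc3 := card_image_mergeLabels (f := κ) huS
      have hc4 := card_image_lt_of_factor (fun w _ w' _ hw => (hq w w' hw).2) huS hvS hκ hquv
      have hc5 : 0 < (S.image κ).card :=
        Finset.card_pos.2 ⟨κ u, Finset.mem_image_of_mem κ huS⟩
      rw [← hq'] at hc1
      rw [← hκ'] at hc3
      have hIH := ih ((Finset.univ.image q').card + (Finset.range n \ B).card)
        (by omega) (q := q') (κ := κ') (B := B)
        (fun w w' hw => ⟨hq'ℓ w w' hw, hq'κ w w' hw⟩) le_rfl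
      have hm1 := mass_add_le h.nonneg (P := Allowed s t ℓ q κ B)
        (Q := fun e => ℓ (s e) = ℓ u ∧ ℓ (t e) = ℓ u ∧ q (s e) ≠ q (t e))
        (R := Allowed s t ℓ q' κ' B)
        (fun e he => by
          rcases he with he | ⟨he1, he2, he3⟩
          · exact Or.inl (mergeLabels_congr he)
          · exact Or.inr ⟨mergeLabels_congr he1, he2, he3⟩)
        (fun e he => by
          refine ⟨Or.inl ?_, fun hA => hA.elim he.2.2 fun hA => hA.2.1 (by omega)⟩
          rw [hq'v, hq'v, if_pos he.1, if_pos he.2.1])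
      have hs1 := h.le_mass_separated (ℓ u) q
      have hs2 := h.layerSlack_le (h.index_le u)
      rw [← hS] at hs1
      have hQ : ((Finset.univ.image q').card : ℝ) =
          (Finset.univ.image q).card + 1 - (S.image q).card := by
        have : ((Finset.univ.image q').card : ℝ) + (S.image q).card =
          (Finset.univ.image q).card + 1 := by exact_mod_cast hc1
        linarith
      have hK : ((Finset.univ.image κ).card : ℝ) + 2 ≤
          (Finset.univ.image κ').card + (S.image q).card := by
        have : (Finset.univ.image κ).card + 2 ≤
          (Finset.univ.image κ').card + (S.image q).card := by omega
        exact_mod_cast this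
      have hmul := mul_le_mul_of_nonneg_left hK (sub_nonneg.2 h.lam_le_one)
      rw [hQ] at hIH
      linarith

end Layered

/-! ### Greedy forests -/

section Forest

variable {V E : Type*} [Fintype V] [DecidableEq V]

/-- The edge set `T` is a forest, and the classes of `κ` are the vertex sets of its components.
That vertices of the same class are connected is expressed by `invariant`: they satisfy the same
predicates among those that are constant along the edges of `T`. That `T` has no cycles is
expressed by `card_inside_add_le`. -/
structure IsForestLabelling (s t : E → V) (T : Finset E) (κ : V → ℕ) : Prop where
  eq_of_mem : ∀ e ∈ T, κ (s e) = κ (t e)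
  invariant : ∀ P : V → Prop, (∀ e ∈ T, P (s e) ↔ P (t e)) → ∀ u v, κ u = κ v → (P u ↔ P v)
  card_inside_add_le : ∀ U : Finset V,
    (T.filter fun e => s e ∈ U ∧ t e ∈ U).card + (U.image κ).card ≤ U.card
  card_add : T.card + (Finset.univ.image κ).card = Fintype.card V

variable {s t : E → V}

theorem exists_isForestLabelling_empty (s t : E → V) : ∃ κ, IsForestLabelling s t ∅ κ := by
  have hinj : Function.Injective fun v : V => (Fintype.equivFin V v : ℕ) :=
    Fin.val_injective.comp (Fintype.equivFin V).injective
  refine ⟨fun v => Fintype.equivFin V v, by simp, fun P _ u v huv => ?_, fun U => ?_, ?_⟩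
  · rw [hinj huv]
  · rw [Finset.card_image_of_injective _ hinj]
    simp
  · rw [Finset.card_image_of_injective _ hinj]
    simp

theorem IsForestLabelling.insert [DecidableEq E] {T : Finset E} {κ : V → ℕ}
    (h : IsForestLabelling s t T κ) {a : E} (ha : κ (s a) ≠ κ (t a)) :
    IsForestLabelling s t (insert a T) fun v => if κ v = κ (t a) then κ (s a) else κ v := by
  have haT : a ∉ T := fun haT => ha (h.eq_of_mem a haT)
  have himg : ∀ U : Finset V, s a ∈ U → t a ∈ U →
      (U.image fun v => if κ v = κ (t a) then κ (s a) else κ v) =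
        (U.image κ).erase (κ (t a)) := by
    intro U hs ht
    ext c
    simp only [Finset.mem_image, Finset.mem_erase]
    constructor
    · rintro ⟨v, hv, rfl⟩
      split_ifs with hvt
      · exact ⟨ha, s a, hs, rfl⟩
      · exact ⟨hvt, v, hv, rfl⟩
    · rintro ⟨hc, v, hv, rfl⟩
      exact ⟨v, hv, if_neg hc⟩
  have hcard : ∀ U : Finset V, s a ∈ U → t a ∈ U →
      (U.image fun v => if κ v = κ (t a) then κ (s a) else κ v).card + 1 =
        (U.image κ).card := by
    intro U hs ht
    rw [himg U hs ht]
    exact Finset.card_erase_add_one (Finset.mem_image_of_mem κ ht)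
  refine ⟨fun e he => ?_, fun P hP u v huv => ?_, fun U => ?_, ?_⟩
  · rcases Finset.mem_insert.1 he with rfl | he
    · simp
    · simp only [h.eq_of_mem e he]
  · have hT := h.invariant P fun e he => hP e (Finset.mem_insert_of_mem he)
    have hPa := hP a (Finset.mem_insert_self a T)
    split_ifs at huv with hu hv hv
    · exact hT u v (hu.trans hv.symm)
    · rw [hT u (t a) hu, ← hPa, hT (s a) v huv]
    · rw [hT v (t a) hv, ← hPa, hT u (s a) huv]
    · exact hT u v huv
  · have hU := h.card_inside_add_le U
    by_cases hst : s a ∈ U ∧ t a ∈ U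
    · have := hcard U hst.1 hst.2
      rw [Finset.filter_insert, if_pos hst, Finset.card_insert_of_notMem (by simp [haT])]
      omega
    · rw [Finset.filter_insert, if_neg hst]
      have : (U.image fun v => if κ v = κ (t a) then κ (s a) else κ v).card ≤
          (U.image κ).card :=
        card_image_le_of_factor fun u _ v _ huv => by simp only [huv]
      omega
  · have := hcard Finset.univ (Finset.mem_univ _) (Finset.mem_univ _)
    have := h.card_add
    rw [Finset.card_insert_of_notMem haT]
    omega

/-- The greedy algorithm: some forest in `S` restricts, for every threshold `r`, to a maximal
forest among the edges of `S` of weight at least `r`. -/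
theorem exists_greedy_forest [DecidableEq E] (s t : E → V) (w : E → ℝ) (S : Finset E) :
    ∃ T ⊆ S, ∀ r : ℝ, ∃ κ, IsForestLabelling s t (T.filter (r ≤ w ·)) κ ∧
      ∀ e ∈ S, r ≤ w e → κ (s e) = κ (t e) := by
  induction S using Finset.induction_on_min_value w with
  | empty =>
    refine ⟨∅, Finset.Subset.refl _, fun r => ?_⟩
    obtain ⟨κ, hκ⟩ := exists_isForestLabelling_empty s t
    exact ⟨κ, by simpa using hκ, by simp⟩
  | insert a S ha hmin ih =>
    obtain ⟨T, hTS, hT⟩ := ih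
    obtain ⟨κ, hκ, hκS⟩ := hT (w a)
    have hfilter : ∀ r ≤ w a, T.filter (r ≤ w ·) = T := fun r hr =>
      Finset.filter_true_of_mem fun e he => hr.trans (hmin e (hTS he))
    rw [hfilter _ le_rfl] at hκ
    by_cases hst : κ (s a) = κ (t a)
    · refine ⟨T, hTS.trans (Finset.subset_insert a S), fun r => ?_⟩
      by_cases hr : r ≤ w a
      · refine ⟨κ, by rwa [hfilter r hr], fun e he _ => ?_⟩
        rcases Finset.mem_insert.1 he with rfl | he
        · exact hst
        · exact hκS e he (hmin e he)
      · obtain ⟨κ', hκ', hκS'⟩ := hT r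
        refine ⟨κ', hκ', fun e he hre => ?_⟩
        rcases Finset.mem_insert.1 he with rfl | he
        · exact absurd hre hr
        · exact hκS' e he hre
    · refine ⟨insert a T, Finset.insert_subset_insert a hTS, fun r => ?_⟩
      by_cases hr : r ≤ w a
      · refine ⟨_, by rw [Finset.filter_insert, if_pos hr, hfilter r hr]; exact hκ.insert hst,
          fun e he _ => ?_⟩
        rcases Finset.mem_insert.1 he with rfl | he
        · simp [hst]
        · simp only [hκS e he (hmin e he)]
      · obtain ⟨κ', hκ', hκS'⟩ := hT r
        refine ⟨κ', by rwa [Finset.filter_insert, if_neg hr], fun e he hre => ?_⟩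
        rcases Finset.mem_insert.1 he with rfl | he
        · exact absurd hre hr
        · exact hκS' e he hre

end Forest

/-! ### Summation by levels -/

/-- If `z` has nonnegative sum over each set `{e ∈ s | r ≤ w e}`, then `∑ (w e - c) * z e` is
nonnegative for any lower bound `c` of `w`. -/
theorem sum_mul_nonneg_of_levels {E : Type*} (s : Finset E) (w z : E → ℝ)
    (h : ∀ r, 0 ≤ ∑ e ∈ s.filter (r ≤ w ·), z e) (c : ℝ) (hc : ∀ e ∈ s, c ≤ w e) :
    0 ≤ ∑ e ∈ s, (w e - c) * z e := by
  induction hn : s.card using Nat.strong_induction_on generalizing s c with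
  | _ n ih =>
    rcases s.eq_empty_or_nonempty with rfl | hs
    · simp
    · obtain ⟨a, ha, hmin⟩ := s.exists_min_image w hs
      have hall : 0 ≤ ∑ e ∈ s, z e := by
        have := h (w a)
        rwa [Finset.filter_true_of_mem hmin] at this
      have hrest : 0 ≤ ∑ e ∈ s.filter (w a < w ·), (w e - w a) * z e := by
        refine ih _ ?_ (s.filter (w a < w ·)) (fun r => ?_) (w a)
          (fun e he => (Finset.mem_filter.1 he).2.le) rfl
        · rw [← hn]
          exact Finset.card_lt_card (Finset.filter_ssubset.2 ⟨a, ha, lt_irrefl _⟩)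
        · rw [Finset.filter_filter]
          by_cases hr : r ≤ w a
          · have hne : ∑ e ∈ s.filter (w a < w ·), z e =
                ∑ e ∈ s.filter (fun e => w a < w e ∧ r ≤ w e), z e := by
              congr 1
              refine Finset.filter_congr fun e _ => ⟨fun h => ⟨h, hr.trans h.le⟩, fun h => h.1⟩
            rw [← hne]
            rcases (s.filter (w a < w ·)).eq_empty_or_nonempty with he | he
            · rw [he]; simp
            · obtain ⟨b, hb, hbmin⟩ := (s.filter (w a < w ·)).exists_min_image w he
              have heq : s.filter (w b ≤ w ·) = s.filter (w a < w ·) := by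
                refine Finset.filter_congr fun e he' => ⟨fun hbe =>
                  (Finset.mem_filter.1 hb).2.trans_le hbe, fun hae =>
                  hbmin e (Finset.mem_filter.2 ⟨he', hae⟩)⟩
              rw [← heq]
              exact h (w b)
          · have heq : s.filter (fun e => w a < w e ∧ r ≤ w e) = s.filter (r ≤ w ·) :=
              Finset.filter_congr fun e _ => ⟨fun h => h.2, fun h =>
                ⟨(not_le.1 hr).trans_le h, h⟩⟩
            rw [heq]
            exact h r
      have hsplit : ∑ e ∈ s, (w e - c) * z e =
          ∑ e ∈ s.filter (w a < w ·), (w e - w a) * z e + (w a - c) * ∑ e ∈ s, z e := by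
        rw [Finset.sum_filter_of_ne, Finset.mul_sum, ← Finset.sum_add_distrib]
        · exact Finset.sum_congr rfl fun e _ => by ring
        · intro e he hne
          refine lt_of_le_of_ne (hmin e he) fun heq => hne ?_
          rw [heq]
          ring
      rw [hsplit]
      exact add_nonneg hrest (mul_nonneg (sub_nonneg.2 (hc a ha)) hall)

/-! ### Chain-points as layered points -/

section ChainPoint

variable {V : Type*}

/-- One of the two ends of the edge `e`; the choice is arbitrary. -/
noncomputable def src {G : SimpleGraph V} (e : G.edgeSet) : V := (Quot.out (e : Sym2 V)).1

/-- The end of the edge `e` other than `src e`. -/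
noncomputable def dst {G : SimpleGraph V} (e : G.edgeSet) : V := (Quot.out (e : Sym2 V)).2

theorem coe_eq_src_dst {G : SimpleGraph V} (e : G.edgeSet) : (e : Sym2 V) = s(src e, dst e) :=
  (Quot.out_eq (e : Sym2 V)).symm

theorem adj_src_dst {G : SimpleGraph V} (e : G.edgeSet) : G.Adj (src e) (dst e) := by
  have := e.2
  rwa [coe_eq_src_dst, SimpleGraph.mem_edgeSet] at this

section Chain

variable [DecidableEq V]

/-- The index of the layer of `v` for the chain `C`: the number of members of `C` that do not
contain `v`. -/
def chainIndex {k : ℕ} (C : Fin (k + 1) → Finset V) (v : V) : ℕ :=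
  (Finset.univ.filter fun i => v ∉ C i).card

theorem mem_chain_iff {k : ℕ} {C : Fin (k + 1) → Finset V} (hC : StrictMono C) (i : Fin (k + 1))
    (v : V) : v ∈ C i ↔ chainIndex C v ≤ i := by
  constructor
  · intro hv
    have hsub : (Finset.univ.filter fun j => v ∉ C j) ⊆ Finset.Iio i := by
      intro j hj
      simp only [Finset.mem_filter, Finset.mem_univ, true_and] at hj
      rw [Finset.mem_Iio]
      by_contra hle
      exact hj (hC.monotone (not_lt.1 hle) hv)
    have := Finset.card_le_card hsub
    rwa [Fin.card_Iio] at this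
  · intro hle
    by_contra hv
    have hsub : Finset.Iic i ⊆ (Finset.univ.filter fun j => v ∉ C j) := by
      intro j hj
      simp only [Finset.mem_filter, Finset.mem_univ, true_and]
      exact fun h => hv (hC.monotone (Finset.mem_Iic.1 hj) h)
    have := Finset.card_le_card hsub
    rw [Fin.card_Iic] at this
    unfold chainIndex at hle
    omega

theorem chainIndex_le {k : ℕ} (C : Fin (k + 1) → Finset V) (v : V) : chainIndex C v ≤ k + 1 :=
  (Finset.card_le_univ _).trans (by simp)

end Chain

variable [Fintype V] {G : SimpleGraph V} [DecidableRel G.Adj]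

theorem weight_eq_mass {x : G.edgeSet → ℝ} {F : Finset G.edgeSet} {P : G.edgeSet → Prop}
    (h : ∀ e, e ∈ F ↔ P e) : weight x F = mass x P := by
  classical
  rw [weight, mass, ← Finset.sum_filter]
  exact Finset.sum_congr (by ext e; simp [h]) fun _ _ => rfl

variable [DecidableEq V]

theorem mem_edgesBetween {S₁ S₂ : Finset V} {e : G.edgeSet} : e ∈ edgesBetween G S₁ S₂ ↔
    (src e ∈ S₁ ∧ dst e ∈ S₂) ∨ (dst e ∈ S₁ ∧ src e ∈ S₂) := by
  simp only [edgesBetween, Finset.mem_filter, Finset.mem_univ, true_and]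
  rw [coe_eq_src_dst]
  constructor
  · rintro ⟨i, hi, j, hj, h⟩
    rcases Sym2.eq_iff.1 h with ⟨rfl, rfl⟩ | ⟨rfl, rfl⟩
    · exact Or.inl ⟨hi, hj⟩
    · exact Or.inr ⟨hi, hj⟩
  · rintro (⟨h1, h2⟩ | ⟨h1, h2⟩)
    · exact ⟨_, h1, _, h2, rfl⟩
    · exact ⟨_, h1, _, h2, Sym2.eq_swap⟩

theorem mem_inducedEdges {S : Finset V} {e : G.edgeSet} :
    e ∈ inducedEdges G S ↔ src e ∈ S ∧ dst e ∈ S := by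
  rw [inducedEdges, mem_edgesBetween]
  tauto

theorem sum_mass_eq {x : G.edgeSet → ℝ} (f : G.edgeSet → V) (L : Finset V) :
    ∑ v ∈ L, mass x (fun e => f e = v) = mass x fun e => f e ∈ L := by
  simp only [mass]
  rw [Finset.sum_comm]
  refine Finset.sum_congr rfl fun e _ => ?_
  by_cases he : f e ∈ L
  · rw [if_pos he, Finset.sum_eq_single (f e)]
    · exact if_pos rfl
    · exact fun v _ hv => if_neg fun h => hv h.symm
    · exact fun h => absurd he h
  · rw [if_neg he]
    refine Finset.sum_eq_zero fun v hv => if_neg ?_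
    rintro rfl
    exact he hv

theorem sum_degree_eq (x : G.edgeSet → ℝ) (L : Finset V) :
    ∑ v ∈ L, weight x (cut G {v}) =
      mass x (fun e => src e ∈ L) + mass x fun e => dst e ∈ L := by
  rw [← sum_mass_eq, ← sum_mass_eq, ← Finset.sum_add_distrib]
  refine Finset.sum_congr rfl fun v _ => ?_
  rw [weight_eq_mass (P := fun e => src e = v ∨ dst e = v)]
  · simp only [mass, ← Finset.sum_add_distrib]
    refine Finset.sum_congr rfl fun e _ => ?_
    have := (adj_src_dst e).ne
    split_ifs <;> first | (exfalso; grind) | simp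
  · intro e
    have := (adj_src_dst e).ne
    rw [cut, mem_edgesBetween]
    simp only [Finset.mem_singleton, Finset.mem_compl]
    grind

theorem layer_chainIndex_succ {k : ℕ} {C : Fin (k + 1) → Finset V} (hC : StrictMono C)
    (i : Fin k) : layer (chainIndex C) (i + 1) = C i.succ \ C i.castSucc := by
  ext v
  rw [mem_layer, Finset.mem_sdiff, mem_chain_iff hC, mem_chain_iff hC]
  simp only [Fin.val_succ, Fin.val_castSucc]
  omega

theorem layer_chainIndex_nonempty {k : ℕ} {C : Fin (k + 1) → Finset V} (hC : IsVertexChain C)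
    {i : ℕ} (hi : i ≤ k + 1) : (layer (chainIndex C) i).Nonempty := by
  rcases i with _ | i
  · obtain ⟨v, hv⟩ := hC.nonempty_zero
    rw [mem_chain_iff hC.strictMono] at hv
    exact ⟨v, by rw [mem_layer]; simpa using hv⟩
  · by_cases hik : i < k
    · have hlt : C (⟨i, hik⟩ : Fin k).castSucc ⊂ C (⟨i, hik⟩ : Fin k).succ :=
        hC.strictMono Fin.castSucc_lt_succ
      obtain ⟨v, hv1, hv2⟩ := Finset.exists_of_ssubset hlt
      refine ⟨v, ?_⟩
      have := layer_chainIndex_succ hC.strictMono ⟨i, hik⟩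
      rw [this]
      exact Finset.mem_sdiff.2 ⟨hv1, hv2⟩
    · obtain ⟨v, -, hv⟩ := Finset.exists_of_ssubset hC.last_ssubset
      rw [mem_chain_iff hC.strictMono] at hv
      have := chainIndex_le C v
      refine ⟨v, mem_layer.2 ?_⟩
      simp only [Fin.val_last] at hv
      omega

theorem mem_cut_chain {k : ℕ} {C : Fin (k + 1) → Finset V} (hC : StrictMono C)
    (i : Fin (k + 1)) (e : G.edgeSet) :
    e ∈ cut G (C i) ↔ Crosses i (chainIndex C (src e)) (chainIndex C (dst e)) := by
  rw [cut, mem_edgesBetween]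
  simp only [Finset.mem_compl, mem_chain_iff hC, Crosses]
  omega

theorem mass_layer_add {E : Type*} [Fintype E] (x : E → ℝ) (a b : E → ℕ) (i : ℕ) :
    mass x (fun e => a e = i + 1) + mass x (fun e => b e = i + 1) =
      2 * mass x (fun e => a e = i + 1 ∧ b e = i + 1) + mass x (fun e => Crosses i (a e) (b e)) +
        mass x (fun e => Crosses (i + 1) (a e) (b e)) -
        2 * mass x (fun e => Jumps (i + 1) (a e) (b e)) := by
  simp only [mass, ← Finset.sum_add_distrib, Finset.mul_sum, ← Finset.sum_sub_distrib]
  refine Finset.sum_congr rfl fun e _ => ?_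
  split_ifs <;> simp only [Crosses, Jumps] at * <;> first | (exfalso; omega) | ring

theorem mass_layer_zero_add {E : Type*} [Fintype E] (x : E → ℝ) (a b : E → ℕ) :
    mass x (fun e => a e = 0) + mass x (fun e => b e = 0) =
      2 * mass x (fun e => a e = 0 ∧ b e = 0) + mass x (fun e => Crosses 0 (a e) (b e)) := by
  simp only [mass, ← Finset.sum_add_distrib, Finset.mul_sum]
  refine Finset.sum_congr rfl fun e _ => ?_
  split_ifs <;> simp only [Crosses] at * <;> first | (exfalso; omega) | ring

theorem mass_eq_zero {E : Type*} [Fintype E] (x : E → ℝ) {P : E → Prop} (h : ∀ e, ¬ P e) :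
    mass x P = 0 :=
  Finset.sum_eq_zero fun e _ => if_neg (h e)

/-- The degree sums of the layers between the first and the last are prescribed, and that of all
vertices is known, so that the degree sums of the first and last layer force their spanning tree
constraints to be tight. -/
theorem IsChainPoint.layerSlack_ends {k : ℕ} {C : Fin (k + 1) → Finset V}
    (hC : IsVertexChain C) {x : G.edgeSet → ℝ} (hx : IsChainPoint G C x) :
    layerSlack src dst x (chainIndex C) 0 = 0 ∧
      layerSlack src dst x (chainIndex C) (k + 1) = 0 := by
  obtain ⟨hnn, hU, hV⟩ := hx.mem_polytope
  set ℓ := chainIndex C with hℓ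
  have hℓle : ∀ v, ℓ v ≤ k + 1 := chainIndex_le C
  have hmass : mass x (fun _ => True) = (Fintype.card V : ℝ) - 1 := by
    rw [← hV]
    exact (weight_eq_mass (by simp)).symm
  have hdeg : ∀ i, ∑ v ∈ layer ℓ i, weight x (cut G {v}) =
      mass x (fun e => ℓ (src e) = i) + mass x (fun e => ℓ (dst e) = i) := by
    intro i
    rw [sum_degree_eq]
    simp only [mem_layer]
  have htotal : ∑ i ∈ Finset.range (k + 2), ∑ v ∈ layer ℓ i, weight x (cut G {v}) =
      2 * ((Fintype.card V : ℝ) - 1) := by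
    have h1 := Finset.sum_fiberwise_of_maps_to (s := Finset.univ) (t := Finset.range (k + 2))
      (g := ℓ) (fun v _ => Finset.mem_range.2 (Nat.lt_succ_of_le (hℓle v)))
      (fun v => weight x (cut G {v}))
    have h2 := sum_degree_eq x (Finset.univ : Finset V)
    simp only [Finset.mem_univ, hmass] at h2
    unfold layer
    linarith
  have hcard : ∑ i ∈ Finset.range (k + 2), ((layer ℓ i).card : ℝ) = Fintype.card V := by
    have := Finset.card_eq_sum_card_fiberwise (s := Finset.univ) (t := Finset.range (k + 2))
      (f := ℓ) (fun v _ => by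
        have := hℓle v
        simp only [Finset.coe_range, Set.mem_Iio]
        omega)
    rw [← Finset.card_univ, this]
    push_cast
    rfl
  have hmid : ∀ i ∈ Finset.range k, ∑ v ∈ layer ℓ (i + 1), weight x (cut G {v}) =
      2 * ((layer ℓ (i + 1)).card : ℝ) := by
    intro i hi
    have := layer_chainIndex_succ hC.strictMono ⟨i, Finset.mem_range.1 hi⟩
    simp only [← hℓ] at this
    rw [this]
    exact hx.level _
  rw [Finset.sum_range_succ, Finset.sum_range_succ', Finset.sum_congr rfl hmid,
    ← Finset.mul_sum, hdeg, hdeg] at htotal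
  rw [Finset.sum_range_succ, Finset.sum_range_succ'] at hcard
  have h0 := mass_layer_zero_add x (fun e => ℓ (src e)) (fun e => ℓ (dst e))
  have hn := mass_layer_add x (fun e => ℓ (src e)) (fun e => ℓ (dst e)) k
  have hc0 : mass x (fun e => Crosses 0 (ℓ (src e)) (ℓ (dst e))) = 1 := by
    rw [← hx.cut_zero]
    exact (weight_eq_mass (mem_cut_chain hC.strictMono 0)).symm
  have hck : mass x (fun e => Crosses k (ℓ (src e)) (ℓ (dst e))) = 1 := by
    rw [← hx.cut_last]
    exact (weight_eq_mass (mem_cut_chain hC.strictMono (Fin.last k))).symm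
  have hck' : mass x (fun e => Crosses (k + 1) (ℓ (src e)) (ℓ (dst e))) = 0 :=
    mass_eq_zero x fun e => by
      have := hℓle (src e)
      have := hℓle (dst e)
      unfold Crosses
      omega
  have hjk : mass x (fun e => Jumps (k + 1) (ℓ (src e)) (ℓ (dst e))) = 0 :=
    mass_eq_zero x fun e => by
      have := hℓle (src e)
      have := hℓle (dst e)
      unfold Jumps
      omega
  have hU' : ∀ i ≤ k + 1, mass x (fun e => ℓ (src e) = i ∧ ℓ (dst e) = i) ≤
      ((layer ℓ i).card : ℝ) - 1 := by
    intro i hi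
    refine le_trans (le_of_eq ?_) (hU (layer ℓ i) (layer_chainIndex_nonempty hC hi))
    exact (weight_eq_mass fun e => by simp only [mem_inducedEdges, mem_layer]).symm
  have h1 := hU' 0 (by omega)
  have h2 := hU' (k + 1) le_rfl
  unfold layerSlack
  constructor <;> linarith

/-- With `α i` and `α (i + 1)` the weights of the cuts below and above layer `i`, and `α = 1` beyond
both ends of the chain, the degree sum of layer `i` shows that its slack and the weight of the
edges that jump over it add up to `(α i + α (i + 1)) / 2 - 1`. Edges across a cut link two
consecutive layers unless they jump over one of them, whence the bound for links. -/
theorem IsChainPoint.isLayeredPoint {k : ℕ} {C : Fin (k + 1) → Finset V}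
    (hC : IsVertexChain C) {x : G.edgeSet → ℝ} (hx : IsChainPoint G C x) {lam : ℝ}
    (hlam : lam = 2 - maxNarrowCut G C x) :
    IsLayeredPoint src dst x (chainIndex C) (k + 1) lam := by
  obtain ⟨hnn, hU, hV⟩ := hx.mem_polytope
  obtain ⟨hs0, hsn⟩ := hx.layerSlack_ends hC
  set ℓ := chainIndex C with hℓ
  have hℓle : ∀ v, ℓ v ≤ k + 1 := chainIndex_le C
  have hcut : ∀ i : Fin (k + 1), weight x (cut G (C i)) =
      mass x fun e => Crosses i (ℓ (src e)) (ℓ (dst e)) :=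
    fun i => weight_eq_mass (mem_cut_chain hC.strictMono i)
  have hmax : ∀ i : Fin (k + 1), weight x (cut G (C i)) ≤ 2 - lam := by
    intro i
    have : weight x (cut G (C i)) ≤ maxNarrowCut G C x :=
      Finset.le_sup' (fun i => weight x (cut G (C i))) (Finset.mem_univ i)
    linarith
  have hle1 : lam ≤ 1 := by
    have := hmax 0
    rw [hx.cut_zero] at this
    linarith
  have hpos : 0 < lam := by
    have : maxNarrowCut G C x < 2 := by
      refine (Finset.sup'_lt_iff _).2 fun i _ => ?_
      by_cases h0 : i = 0
      · rw [h0, hx.cut_zero]; norm_num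
      · by_cases hk : i = Fin.last k
        · rw [hk, hx.cut_last]; norm_num
        · exact hx.cut_lt i h0 hk
    linarith
  -- The cut values, extended by `1` beyond both ends of the chain.
  obtain ⟨α, hα⟩ : ∃ α : ℕ → ℝ, α = fun j => if j = 0 then 1 else if j ≤ k + 1 then
      mass x (fun e => Crosses (j - 1) (ℓ (src e)) (ℓ (dst e))) else 1 := ⟨_, rfl⟩
  have hα1 : ∀ i ≤ k, α (i + 1) = mass x fun e => Crosses i (ℓ (src e)) (ℓ (dst e)) := by
    intro i hi
    simp [hα, hi]
  have hα0 : α 0 = 1 := by simp [hα]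
  have hαn : α (k + 2) = 1 := by simp [hα]
  have hαle : ∀ j, α j ≤ 2 - lam := by
    intro j
    rcases j with _ | i
    · rw [hα0]; linarith
    · by_cases hi : i ≤ k
      · rw [hα1 i hi]
        have := hmax ⟨i, Nat.lt_succ_of_le hi⟩
        rwa [hcut] at this
      · have : α (i + 1) = 1 := by simp [hα, hi]
        rw [this]; linarith
  have hslack : ∀ i ≤ k + 1, layerSlack src dst x ℓ i +
      mass x (fun e => Jumps i (ℓ (src e)) (ℓ (dst e))) = (α i + α (i + 1)) / 2 - 1 := by
    intro i hi
    rcases i with _ | i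
    · have hj : mass x (fun e => Jumps 0 (ℓ (src e)) (ℓ (dst e))) = 0 :=
        mass_eq_zero x fun e => by unfold Jumps; omega
      have h1 : α 1 = 1 := by
        rw [hα1 0 (by omega), ← hx.cut_zero, hcut]
        rfl
      rw [hs0, hj, hα0, h1]
      norm_num
    · by_cases hik : i < k
      · have hadd := mass_layer_add x (fun e => ℓ (src e)) (fun e => ℓ (dst e)) i
        have hlev : ∑ v ∈ layer ℓ (i + 1), weight x (cut G {v}) =
            2 * ((layer ℓ (i + 1)).card : ℝ) := by
          have := layer_chainIndex_succ hC.strictMono ⟨i, hik⟩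
          simp only [← hℓ] at this
          rw [this]
          exact hx.level _
        rw [sum_degree_eq] at hlev
        simp only [mem_layer] at hlev
        rw [hα1 i (by omega), hα1 (i + 1) (by omega)]
        unfold layerSlack
        linarith
      · obtain rfl : i = k := by omega
        have hj : mass x (fun e => Jumps (i + 1) (ℓ (src e)) (ℓ (dst e))) = 0 :=
          mass_eq_zero x fun e => by
            have := hℓle (src e)
            have := hℓle (dst e)
            unfold Jumps
            omega
        have h1 : α (i + 1) = 1 := by
          rw [hα1 i le_rfl, ← hx.cut_last, hcut]
          rfl
        rw [hsn, hj, h1, hαn]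
        norm_num
  refine ⟨hnn, hpos, hle1, chainIndex_le C, fun i hi => layer_chainIndex_nonempty hC hi,
    fun U hne => ?_, ?_, fun i hi => ?_, fun i hi => ?_, fun i hi => ?_⟩
  · refine le_trans (le_of_eq ?_) (hU U hne)
    exact (weight_eq_mass fun e => mem_inducedEdges).symm
  · rw [← hV]
    exact (weight_eq_mass (by simp)).symm
  · rw [← hα1 i (by omega)]
    exact hαle _
  · rw [hslack i hi]
    have := hαle i
    have := hαle (i + 1)
    linarith
  · have h1 : mass x (fun e => Crosses i (ℓ (src e)) (ℓ (dst e))) ≤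
        mass x (fun e => Links i (ℓ (src e)) (ℓ (dst e))) +
        mass x fun e => Jumps i (ℓ (src e)) (ℓ (dst e)) ∨ Jumps (i + 1) (ℓ (src e)) (ℓ (dst e)) :=
      mass_le_add hnn fun e he => by
        unfold Crosses at he
        unfold Links Jumps
        omega
    have h2 := mass_le_add hnn (P := fun e => Jumps i (ℓ (src e)) (ℓ (dst e)) ∨
        Jumps (i + 1) (ℓ (src e)) (ℓ (dst e)))
      (Q := fun e => Jumps i (ℓ (src e)) (ℓ (dst e)))
      (R := fun e => Jumps (i + 1) (ℓ (src e)) (ℓ (dst e))) fun e he => he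
    have h3 := hslack i (by omega)
    have h4 := hslack (i + 1) (by omega)
    rw [← hα1 i (by omega)] at h1
    have := hαle i
    have := hαle (i + 1 + 1)
    linarith

end ChainPoint

/-! ### Greedy spanning trees and greedy Gao-trees -/

section Trees

theorem weight_incidence {V : Type*} [DecidableEq V] {G : SimpleGraph V} (T F : Finset G.edgeSet) :
    weight (incidence T) F = ((T.filter (· ∈ F)).card : ℝ) := by
  rw [weight]
  simp only [incidence, Finset.sum_ite_mem, Finset.sum_const, nsmul_eq_mul, mul_one]
  rw [Finset.inter_comm, ← Finset.filter_mem_eq_inter]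

variable {V : Type*} [Fintype V] {G : SimpleGraph V}

theorem isSpanningTree_of_invariant {T : Finset G.edgeSet}
    (hconn : ∀ P : V → Prop, (∀ e ∈ T, P (src e) ↔ P (dst e)) → ∀ u v, P u ↔ P v)
    (hcard : T.card + 1 = Fintype.card V) : IsSpanningTree G T := by
  rw [IsSpanningTree, SimpleGraph.isTree_iff_connected_and_card]
  set H := SimpleGraph.fromEdgeSet (Subtype.val '' (T : Set G.edgeSet)) with hH
  have hedge : H.edgeSet = Subtype.val '' (T : Set G.edgeSet) := by
    rw [hH, SimpleGraph.edgeSet_fromEdgeSet]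
    refine sdiff_eq_left.2 (Set.disjoint_left.2 ?_)
    rintro _ ⟨e, -, rfl⟩ hdiag
    exact G.not_isDiag_of_mem_edgeSet e.2 hdiag
  constructor
  · have : Nonempty V := Fintype.card_pos_iff.1 (by omega)
    refine ⟨fun u v => ?_⟩
    refine (hconn (fun v => H.Reachable u v) (fun e he => ?_) u v).1
      (SimpleGraph.Reachable.refl u)
    have hadj : H.Adj (src e) (dst e) := by
      rw [← SimpleGraph.mem_edgeSet, hedge, ← coe_eq_src_dst]
      exact ⟨e, he, rfl⟩
    exact ⟨fun h => h.trans hadj.reachable, fun h => h.trans hadj.symm.reachable⟩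
  · rw [hedge, Nat.card_image_of_injective Subtype.val_injective, Nat.card_eq_fintype_card,
      Nat.card_eq_fintype_card]
    simpa using hcard

variable [DecidableRel G.Adj] [DecidableEq V] {k : ℕ} {C : Fin (k + 1) → Finset V}
  {x : G.edgeSet → ℝ} {lam : ℝ}

/-- The greedy spanning tree contains, for every `r`, a maximal forest among the edges of weight
at least `r`. The classes of `κ` are the vertex sets of the components of this forest, which gives
the number of its edges. -/
theorem exists_greedy_spanningTree
    (h : IsLayeredPoint src dst x (chainIndex C) (k + 1) lam) (w : G.edgeSet → ℝ) :
    ∃ T : Finset G.edgeSet, incidence T ∈ spanningTreePolytope G ∧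
      T.card + 1 = Fintype.card V ∧ ∀ r : ℝ, ∃ κ : V → ℕ,
        (∀ e, r ≤ w e → κ (src e) = κ (dst e)) ∧
        (T.filter (r ≤ w ·)).card + (Finset.univ.image κ).card = Fintype.card V := by
  classical
  obtain ⟨T, -, hT⟩ := exists_greedy_forest (src (G := G)) dst w Finset.univ
  obtain ⟨r₀, hr₀⟩ := (Set.finite_range w).bddBelow
  have hr₀ : ∀ e, r₀ ≤ w e := fun e => hr₀ ⟨e, rfl⟩
  obtain ⟨κ, hκ, hκE⟩ := hT r₀
  rw [Finset.filter_true_of_mem fun e _ => hr₀ e] at hκ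
  have hV : Nonempty V := let ⟨v, _⟩ := h.layer_nonempty 0 (by omega); ⟨v⟩
  have hone : (Finset.univ.image κ).card = 1 := by
    refine le_antisymm ?_ (Finset.card_pos.2 (Finset.univ_nonempty.image κ))
    have h1 : mass x (fun _ => True) ≤ (Fintype.card V : ℝ) - (Finset.univ.image κ).card :=
      (mass_mono h.nonneg fun e _ => by
        simp [hκE e (Finset.mem_univ e) (hr₀ e)]).trans (h.mass_same_label_le Finset.univ κ)
    rw [h.mass_univ] at h1
    have : ((Finset.univ.image κ).card : ℝ) ≤ 1 := by linarith
    exact_mod_cast this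
  have hcard : T.card + 1 = Fintype.card V := by rw [← hone]; exact hκ.card_add
  refine ⟨T, ⟨fun e => ?_, fun U hU => ?_, ?_⟩, hcard, fun r => ?_⟩
  · unfold incidence
    split_ifs <;> norm_num
  · rw [weight_incidence]
    have h1 := hκ.card_inside_add_le U
    have h2 : 0 < (U.image κ).card := Finset.card_pos.2 (hU.image κ)
    have h3 : T.filter (· ∈ inducedEdges G U) = T.filter fun e => src e ∈ U ∧ dst e ∈ U :=
      Finset.filter_congr fun e _ => mem_inducedEdges
    rw [h3, le_sub_iff_add_le]
    exact_mod_cast (by omega : _ + 1 ≤ U.card)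
  · rw [weight_incidence, ← hcard]
    simp
  · obtain ⟨κ', hκ', hκE'⟩ := hT r
    exact ⟨κ', fun e => hκE' e (Finset.mem_univ e), hκ'.card_add⟩

/-- The greedy Gao-tree consists of a greedy forest within the layers and of the heaviest edge
between each two consecutive layers. For the edges of weight at least `r`, the classes of `q` are
the vertex sets of the components of the forest, and `B` is the set of those `i` for which some
edge between the layers `i` and `i + 1` is among them; this gives the number of edges of the tree
that have weight at least `r`. -/
theorem exists_greedy_gaoTree (hC : IsVertexChain C)
    (h : IsLayeredPoint src dst x (chainIndex C) (k + 1) lam) (w : G.edgeSet → ℝ) :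
    ∃ T : Finset G.edgeSet, IsGaoTree G C T ∧
      T.card + 1 = Fintype.card V ∧ ∀ r : ℝ, ∃ (q : V → ℕ) (B : Finset ℕ),
        (∀ u v, q u = q v → chainIndex C u = chainIndex C v) ∧
        (∀ κ : V → ℕ, (∀ e, r ≤ w e → κ (src e) = κ (dst e)) → ∀ u v, q u = q v → κ u = κ v) ∧
        (∀ e, r ≤ w e → chainIndex C (src e) = chainIndex C (dst e) → q (src e) = q (dst e)) ∧
        (∀ e i, r ≤ w e → Links i (chainIndex C (src e)) (chainIndex C (dst e)) → i ∈ B) ∧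
        (T.filter (r ≤ w ·)).card + (Finset.univ.image q).card =
          Fintype.card V + B.card := by
  classical
  set ℓ := chainIndex C with hℓ
  obtain ⟨T, hTS, hT⟩ := exists_greedy_forest (src (G := G)) dst w
    (Finset.univ.filter fun e => ℓ (src e) = ℓ (dst e))
  have hTℓ : ∀ e ∈ T, ℓ (src e) = ℓ (dst e) := fun e he => (Finset.mem_filter.1 (hTS he)).2
  have hlink : ∀ i : Fin (k + 1), ∃ e : G.edgeSet, Links i (ℓ (src e)) (ℓ (dst e)) ∧
      ∀ e' : G.edgeSet, Links i (ℓ (src e')) (ℓ (dst e')) → w e' ≤ w e := by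
    intro i
    have hne : (Finset.univ.filter fun e : G.edgeSet =>
        Links i (ℓ (src e)) (ℓ (dst e))).Nonempty := by
      by_contra hempty
      have h1 := h.le_links i i.2
      rw [mass_eq_zero x fun e he => hempty ⟨e, by simpa using he⟩] at h1
      have h2 := h.layerSlack_nonneg (i := i) (by omega)
      have h3 := h.layerSlack_nonneg (i := i + 1) (by omega)
      linarith [h.lam_pos]
    obtain ⟨e, he, hmax⟩ := Finset.exists_max_image _ w hne
    exact ⟨e, (Finset.mem_filter.1 he).2, fun e' he' => hmax e' (by simpa using he')⟩
  choose ε hε hεmax using hlink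
  have hεinj : Function.Injective ε := by
    intro i j hij
    have h1 := hε i
    have h2 := hε j
    rw [hij] at h1
    unfold Links at h1 h2
    omega
  have hdisj : ∀ i, ε i ∉ T := fun i hi => by
    have h1 := hTℓ _ hi
    have h2 := hε i
    unfold Links at h2
    omega
  have hfilter : ∀ r : ℝ, ((T ∪ Finset.univ.image ε).filter (r ≤ w ·)).card =
      (T.filter (r ≤ w ·)).card + (Finset.univ.filter fun i => r ≤ w (ε i)).card := by
    intro r
    rw [Finset.filter_union, Finset.card_union_of_disjoint, Finset.filter_image,
      Finset.card_image_of_injective _ hεinj]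
    rw [Finset.disjoint_left]
    intro e he he'
    obtain ⟨i, -, rfl⟩ := Finset.mem_image.1 (Finset.mem_filter.1 he').1
    exact hdisj i (Finset.mem_filter.1 he).1
  obtain ⟨r₀, hr₀⟩ := (Set.finite_range w).bddBelow
  have hr₀ : ∀ e, r₀ ≤ w e := fun e => hr₀ ⟨e, rfl⟩
  obtain ⟨q, hq, hqE⟩ := hT r₀
  rw [Finset.filter_true_of_mem fun e _ => hr₀ e] at hq
  have hqℓ : ∀ u v, q u = q v ↔ ℓ u = ℓ v := by
    refine fun u v => ⟨fun huv => ?_, fun huv => ?_⟩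
    · exact ((hq.invariant (fun v' => ℓ u = ℓ v') (fun e he => by rw [hTℓ e he]) u v huv).1 rfl)
    · -- The parts of a layer are separated by too little weight for there to be two of them.
      have h1 := h.le_mass_separated (ℓ u) q
      rw [mass_eq_zero x fun e he => he.2.2 (hqE e (by simp [he.1, he.2.1]) (hr₀ e))] at h1
      have h2 := h.layerSlack_le (h.index_le u)
      have h3 : (((layer ℓ (ℓ u)).image q).card : ℝ) < 2 := by linarith [h.lam_pos]
      have h4 : ((layer ℓ (ℓ u)).image q).card < 2 := by exact_mod_cast h3
      exact Finset.card_le_one.1 (Nat.le_of_lt_succ h4) _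
        (Finset.mem_image_of_mem q (by simp)) _ (Finset.mem_image_of_mem q (by simp [huv]))
  have hqcard : (Finset.univ.image q).card = k + 2 := by
    have h1 : Finset.univ.image ℓ = Finset.range (k + 2) := by
      ext i
      simp only [Finset.mem_image, Finset.mem_univ, true_and, Finset.mem_range]
      constructor
      · rintro ⟨v, rfl⟩
        exact Nat.lt_succ_of_le (h.index_le v)
      · intro hi
        obtain ⟨v, hv⟩ := h.layer_nonempty i (by omega)
        exact ⟨v, mem_layer.1 hv⟩
    rw [← Finset.card_range (k + 2), ← h1]
    exact le_antisymm (card_image_le_of_factor fun u _ v _ huv => (hqℓ u v).2 huv)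
      (card_image_le_of_factor fun u _ v _ huv => (hqℓ u v).1 huv)
  have hcard : (T ∪ Finset.univ.image ε).card + 1 = Fintype.card V := by
    have h1 := hfilter r₀
    rw [Finset.filter_true_of_mem fun e _ => hr₀ e, Finset.filter_true_of_mem fun e _ => hr₀ e,
      Finset.filter_true_of_mem fun i _ => hr₀ (ε i), Finset.card_univ, Fintype.card_fin] at h1
    have h2 := hq.card_add
    omega
  have hconn : ∀ P : V → Prop, (∀ e ∈ T ∪ Finset.univ.image ε, P (src e) ↔ P (dst e)) →
      ∀ u v, P u ↔ P v := by
    intro P hP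
    have hlayer : ∀ u v, ℓ u = ℓ v → (P u ↔ P v) := fun u v huv =>
      hq.invariant P (fun e he => hP e (Finset.mem_union_left _ he)) u v ((hqℓ u v).2 huv)
    obtain ⟨v₀, hv₀⟩ := h.layer_nonempty 0 (by omega)
    have hall : ∀ j v, ℓ v = j → (P v ↔ P v₀) := by
      intro j
      induction j with
      | zero => exact fun v hv => hlayer v v₀ (by rw [hv, mem_layer.1 hv₀])
      | succ j ih =>
        intro v hv
        have hj : j < k + 1 := by have := h.index_le v; omega
        have hPe := hP (ε ⟨j, hj⟩) (Finset.mem_union_right _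
          (Finset.mem_image_of_mem ε (Finset.mem_univ _)))
        rcases hε ⟨j, hj⟩ with ⟨h1, h2⟩ | ⟨h1, h2⟩
        · rw [hlayer v _ (hv.trans h2.symm), ← hPe]
          exact ih _ h1
        · rw [hlayer v _ (hv.trans h2.symm), hPe]
          exact ih _ h1
    exact fun u v => (hall _ u rfl).trans (hall _ v rfl).symm
  refine ⟨T ∪ Finset.univ.image ε, ⟨isSpanningTree_of_invariant hconn hcard, fun i => ?_⟩, hcard,
    fun r => ?_⟩
  · rw [Finset.card_eq_one]
    refine ⟨ε i, ?_⟩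
    ext e
    rw [Finset.mem_inter, mem_cut_chain hC.strictMono, ← hℓ, Finset.mem_singleton, Finset.mem_union,
      Finset.mem_image]
    constructor
    · rintro ⟨he | ⟨j, -, rfl⟩, hcross⟩
      · have := hTℓ e he
        unfold Crosses at hcross
        omega
      · have := hε j
        congr 1
        unfold Crosses at hcross
        unfold Links at this
        omega
    · rintro rfl
      refine ⟨Or.inr ⟨i, Finset.mem_univ i, rfl⟩, ?_⟩
      have := hε i
      unfold Links at this
      unfold Crosses
      omega
  · obtain ⟨q', hq', hqE'⟩ := hT r
    refine ⟨q', (Finset.univ.filter fun i => r ≤ w (ε i)).image Fin.val, fun u v huv => ?_,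
      fun κ hκ u v huv => ?_, fun e hr he => hqE' e (by simpa using he) hr,
      fun e i hr hi => ?_, ?_⟩
    · exact (hq'.invariant (fun v' => ℓ u = ℓ v')
        (fun e he => by rw [hTℓ e (Finset.mem_filter.1 he).1]) u v huv).1 rfl
    · exact (hq'.invariant (fun v' => κ u = κ v')
        (fun e he => by rw [hκ e (Finset.mem_filter.1 he).2]) u v huv).1 rfl
    · have hi' : i < k + 1 := by
        have := h.index_le (src e)
        have := h.index_le (dst e)
        unfold Links at hi
        omega
      exact Finset.mem_image.2 ⟨⟨i, hi'⟩, Finset.mem_filter.2 ⟨Finset.mem_univ _,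
        hr.trans (hεmax ⟨i, hi'⟩ e hi)⟩, rfl⟩
    · rw [hfilter, Finset.card_image_of_injective _ Fin.val_injective]
      have := hq'.card_add
      omega

/-- For every weight function, the combination `λ y + (1 - λ) x'` of some Gao-tree and some
spanning tree has at least the weight of `x`. Both trees are greedy for the same weights, so that
by `IsLayeredPoint.rank_inequality` the combination beats `x` on every set `{e | r ≤ w e}`. -/
theorem exists_trees_of_weight (hC : IsVertexChain C) (hx : x ∈ spanningTreePolytope G)
    (h : IsLayeredPoint src dst x (chainIndex C) (k + 1) lam) (w : G.edgeSet → ℝ) :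
    ∃ T₁ T₂ : Finset G.edgeSet, IsGaoTree G C T₁ ∧ incidence T₂ ∈ spanningTreePolytope G ∧
      ∑ e, w e * x e ≤ ∑ e, w e * (lam * incidence T₁ e + (1 - lam) * incidence T₂ e) := by
  classical
  obtain ⟨T₁, hT₁, hcard₁, hlevel₁⟩ := exists_greedy_gaoTree hC h w
  obtain ⟨T₂, hT₂, hcard₂, hlevel₂⟩ := exists_greedy_spanningTree h w
  refine ⟨T₁, T₂, hT₁, hT₂, ?_⟩
  have hinc : ∀ (T : Finset G.edgeSet) (r : ℝ),
      ∑ e ∈ Finset.univ.filter (r ≤ w ·), incidence T e = ((T.filter (r ≤ w ·)).card : ℝ) := by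
    intro T r
    have := weight_incidence T (Finset.univ.filter (r ≤ w ·))
    simpa [weight] using this
  have hlevel : ∀ r : ℝ, 0 ≤ ∑ e ∈ Finset.univ.filter (r ≤ w ·),
      (lam * incidence T₁ e + (1 - lam) * incidence T₂ e - x e) := by
    intro r
    obtain ⟨κ, hκ, hκc⟩ := hlevel₂ r
    obtain ⟨q, B, hqℓ, hqκ, hqe, hB, hqc⟩ := hlevel₁ r
    have h1 := h.rank_inequality (B := B) fun u v huv => ⟨hqℓ u v huv, hqκ κ hκ u v huv⟩
    have h2 : mass x (fun e => r ≤ w e) ≤ mass x (Allowed src dst (chainIndex C) q κ B) := by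
      refine mass_mono h.nonneg fun e he => ?_
      by_cases hℓe : chainIndex C (src e) = chainIndex C (dst e)
      · exact Or.inl (hqe e he hℓe)
      · exact Or.inr ⟨hκ e he, hℓe, fun i hi => hB e i he hi⟩
    have h3 : ∑ e ∈ Finset.univ.filter (r ≤ w ·), x e = mass x (fun e => r ≤ w e) :=
      weight_eq_mass (F := Finset.univ.filter (r ≤ w ·)) (by simp)
    rw [Finset.sum_sub_distrib, Finset.sum_add_distrib, ← Finset.mul_sum, ← Finset.mul_sum,
      hinc, hinc, h3]
    have e1 : ((T₁.filter (r ≤ w ·)).card : ℝ) =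
        Fintype.card V - (Finset.univ.image q).card + B.card := by
      have : ((T₁.filter (r ≤ w ·)).card : ℝ) + (Finset.univ.image q).card =
        Fintype.card V + B.card := by exact_mod_cast hqc
      linarith
    have e2 : ((T₂.filter (r ≤ w ·)).card : ℝ) =
        Fintype.card V - (Finset.univ.image κ).card := by
      have : ((T₂.filter (r ≤ w ·)).card : ℝ) + (Finset.univ.image κ).card =
        Fintype.card V := by exact_mod_cast hκc
      linarith
    rw [e1, e2]
    linarith
  obtain ⟨c, hc⟩ := (Set.finite_range w).bddBelow
  have hc : ∀ e, c ≤ w e := fun e => hc ⟨e, rfl⟩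
  have hmain := sum_mul_nonneg_of_levels Finset.univ w
    (fun e => lam * incidence T₁ e + (1 - lam) * incidence T₂ e - x e) hlevel c fun e _ => hc e
  have hzero : ∑ e, (lam * incidence T₁ e + (1 - lam) * incidence T₂ e - x e) = 0 := by
    have h1 := hinc T₁ c
    have h2 := hinc T₂ c
    rw [Finset.filter_true_of_mem fun e _ => hc e, Finset.filter_true_of_mem fun e _ => hc e]
      at h1 h2
    have h3 : ∑ e, x e = (Fintype.card V : ℝ) - 1 := hx.2.2
    rw [Finset.sum_sub_distrib, Finset.sum_add_distrib, ← Finset.mul_sum, ← Finset.mul_sum,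
      h1, h2, h3, ← hcard₁]
    have : T₁.card = T₂.card := by omega
    rw [this]
    push_cast
    ring
  have hsplit : ∑ e, (w e - c) * (lam * incidence T₁ e + (1 - lam) * incidence T₂ e - x e) =
      ∑ e, w e * (lam * incidence T₁ e + (1 - lam) * incidence T₂ e) - ∑ e, w e * x e -
        c * ∑ e, (lam * incidence T₁ e + (1 - lam) * incidence T₂ e - x e) := by
    rw [Finset.mul_sum, ← Finset.sum_sub_distrib, ← Finset.sum_sub_distrib]
    exact Finset.sum_congr rfl fun e _ => by ring
  rw [hsplit, hzero] at hmain
  linarith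

theorem convex_spanningTreePolytope : Convex ℝ (spanningTreePolytope G) := by
  intro y hy z hz a b ha hb hab
  have hlin : ∀ F : Finset G.edgeSet,
      weight (a • y + b • z) F = a * weight y F + b * weight z F := by
    intro F
    simp [weight, Finset.sum_add_distrib, Finset.mul_sum]
  refine ⟨fun e => ?_, fun U hU => ?_, ?_⟩
  · have := mul_nonneg ha (hy.1 e)
    have := mul_nonneg hb (hz.1 e)
    simp only [Pi.add_apply, Pi.smul_apply, smul_eq_mul]
    linarith
  · rw [hlin]
    have := mul_le_mul_of_nonneg_left (hy.2.1 U hU) ha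
    have := mul_le_mul_of_nonneg_left (hz.2.1 U hU) hb
    have hU' : ((U.card : ℝ) - 1) = a * (U.card - 1) + b * (U.card - 1) := by
      rw [← add_mul, hab, one_mul]
    linarith
  · rw [hlin, hy.2.2, hz.2.2, ← add_mul, hab, one_mul]

end Trees

end GaoTrees

open scoped Pointwise in
theorem theorem3 {V : Type*} [Fintype V] [DecidableEq V] (G : SimpleGraph V)
    [DecidableRel G.Adj] (k : ℕ) (C : Fin (k + 1) → Finset V)
    (hC : GaoTrees.IsVertexChain C) (x : G.edgeSet → ℝ) (hx : GaoTrees.IsChainPoint G C x)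
    (lam : ℝ) (hlam : lam = 2 - GaoTrees.maxNarrowCut G C x) :
    ∃ y ∈ GaoTrees.gaoTreePolytope G C, ∃ x' ∈ GaoTrees.spanningTreePolytope G,
      x = lam • y + (1 - lam) • x' := by
  have h := hx.isLayeredPoint hC hlam
  set A₁ : Set (G.edgeSet → ℝ) :=
    {y | ∃ T : Finset G.edgeSet, GaoTrees.IsGaoTree G C T ∧ y = GaoTrees.incidence T} with hA₁
  set A₂ : Set (G.edgeSet → ℝ) := {z | (∃ T : Finset G.edgeSet, z = GaoTrees.incidence T) ∧
    z ∈ GaoTrees.spanningTreePolytope G} with hA₂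
  have hfin₁ : A₁.Finite := (Set.finite_range (GaoTrees.incidence (G := G))).subset <| by
    rintro _ ⟨T, -, rfl⟩
    exact ⟨T, rfl⟩
  have hfin₂ : A₂.Finite := (Set.finite_range (GaoTrees.incidence (G := G))).subset <| by
    rintro _ ⟨⟨T, rfl⟩, -⟩
    exact ⟨T, rfl⟩
  have hmem : x ∈ convexHull ℝ (lam • A₁ + (1 - lam) • A₂) := by
    by_contra hnot
    obtain ⟨f, u, hf, hfx⟩ := geometric_hahn_banach_closed_point (convex_convexHull ℝ _)
      (((hfin₁.smul_set).add hfin₂.smul_set).isClosed_convexHull ℝ) hnot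
    have hsum : ∀ y : G.edgeSet → ℝ, f y = ∑ e, f (fun j => if e = j then 1 else 0) * y e := by
      intro y
      have := LinearMap.pi_apply_eq_sum_univ (f : (G.edgeSet → ℝ) →ₗ[ℝ] ℝ) y
      simpa [mul_comm] using this
    obtain ⟨T₁, T₂, hT₁, hT₂, hle⟩ := GaoTrees.exists_trees_of_weight hC hx.mem_polytope h
      fun e => f fun j => if e = j then 1 else 0
    have hlt := hf _ (subset_convexHull ℝ _ (Set.add_mem_add
      (Set.smul_mem_smul_set (a := lam) (show GaoTrees.incidence T₁ ∈ A₁ from ⟨T₁, hT₁, rfl⟩))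
      (Set.smul_mem_smul_set (a := 1 - lam)
        (show GaoTrees.incidence T₂ ∈ A₂ from ⟨⟨T₂, rfl⟩, hT₂⟩))))
    rw [hsum] at hlt hfx
    simp only [Pi.add_apply, Pi.smul_apply, smul_eq_mul] at hlt
    linarith
  rw [convexHull_add, convexHull_smul, convexHull_smul] at hmem
  obtain ⟨_, ⟨y, hy, rfl⟩, _, ⟨z, hz, rfl⟩, hxyz⟩ := hmem
  exact ⟨y, hy, z, convexHull_min (fun _ hz => hz.2) GaoTrees.convex_spanningTreePolytope hz,
    hxyz.symm⟩
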